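/- Let $K$ be a field of characteristic $0$ with algebraic closure $\overline K$, and let $f\in K(z)$ be a rational function of degree $3$, viewed as a self-map of $\mathbb P^1(\overline K)$. Let $\mathrm{Fix}(f)\subset\mathbb P^1(\overline K)$ be the set of (distinct) fixed points of $f$. The multiplier of $f$ at a fixed point $P$ is $f'(P)\in\overline K$, computed in the coordinate $1/z$ if $P=\infty$. For $\rho\in\mathrm{PGL}_2(\overline K)$ put $f^\rho=\rho^{-1}\circ f\circ\rho$, and let $\mathrm{Aut}(f)=\{\alpha\in\mathrm{PGL}_2(\overline K): f^\alpha=f\}$. A rational function $g$ is in *fixed-point multiplier form* if it has at least three distinct fixed points and every fixed point is equal to its multiplier. It is in *partial fixed-point multiplier form* if either it has at most three fixed points and each of them is equal to its multiplier, or it has four fixed points and at least three of them are equal to their multipliers. **Theorem.** There exists $\rho\in\mathrm{PGL}_2(\overline K)$ such that $f^\rho$ is in partial fixed-point multiplier form and is defined over $K$ if and only if both of the following conditions hold. 1. $f$ has at least $\min(\#\mathrm{Fix}(f),3)$ distinct fixed-point multipliers. 2. At least one of the following holds. - (a) There is a $\mathrm{Gal}(\overline K/K)$-invariant set of $\min(\#\mathrm{Fix}(f),3)$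 distinct fixed points of $f$ whose multipliers are pairwise distinct. - (b) $\mathrm{Aut}(f)$ has order $2$, and, with $\alpha$ its nontrivial element, there is a fixed point $x$ of $f$ with $\alpha(x)\neq x$ such that every $\sigma\in\mathrm{Gal}(\overline K/K)$ satisfies $\sigma(x)=x$ or $\sigma(x)=\alpha(x)$. - (c) There is $\rho\in\mathrm{PGL}_2(\overline K)$ such that $f^\rho$ is in fixed-point multiplier form and is the degree $3$ rational function defined over $K$ whose set of fixed points is $\{x_1,x_2,x_3,x_4\}$, each equal to its multiplier, for some distinct $x_1,\dots,x_4\in\overline K\setminus\{1\}$ that form a $\mathrm{Gal}(\overline K/K)$-invariant set and satisfy $\sum_{i=1}^4\frac1{1-x_i}=1$. -/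

import Mathlib

open Polynomial OnePoint
open scoped MatrixGroups Classical

namespace RatMap

section Field

variable {L : Type*} [Field L]

/-- The degree of a rational function `p / q` in lowest terms: `max (deg p) (deg q)`. -/
noncomputable def deg (f : RatFunc L) : ℕ :=
  max f.num.natDegree f.denom.natDegree

/-- A rational function in lowest terms `p / q`, as a self-map of the projective line
`ℙ¹(L) = L ∪ {∞}`. -/
noncomputable def onP1 (f : RatFunc L) : OnePoint L → OnePoint L
  | ∞ => if f.denom.natDegree < f.num.natDegree then ∞
      else ((f.num.coeff f.denom.natDegree / f.denom.leadingCoeff : L) : OnePoint L)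
  | (x : L) => if f.denom.eval x = 0 then ∞
      else ((f.num.eval x / f.denom.eval x : L) : OnePoint L)

/-- The set of fixed points of `f` in `ℙ¹(L)`. -/
def Fix (f : RatFunc L) : Set (OnePoint L) := {P | onP1 f P = P}

/-- The formal derivative `(p' q - p q') / q ^ 2` of `f = p / q` at a point `x` of `L`. -/
noncomputable def derivAt (f : RatFunc L) (x : L) : L :=
  (derivative f.num * f.denom - f.num * derivative f.denom).eval x / (f.denom.eval x) ^ 2

/-- The multiplier of `f` at a fixed point: `f'(x)` at `x ≠ ∞`, and at `∞` the derivative at `0`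
of `1 / f (1 / z)`, the map `f` in the coordinate `1 / z`. -/
noncomputable def multiplier (f : RatFunc L) : OnePoint L → L
  | ∞ => derivAt (f.eval RatFunc.C (RatFunc.X⁻¹ : RatFunc L))⁻¹ 0
  | (x : L) => derivAt f x

/-- The Möbius transformation `(a h + b) / (c h + d)` applied to a rational function `h`. -/
noncomputable def mobius (A : GL (Fin 2) L) (h : RatFunc L) : RatFunc L :=
  (RatFunc.C (A 0 0) * h + RatFunc.C (A 0 1)) / (RatFunc.C (A 1 0) * h + RatFunc.C (A 1 1))

/-- The conjugate `A⁻¹ ∘ f ∘ A`. -/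
noncomputable def conjGL (A : GL (Fin 2) L) (f : RatFunc L) : RatFunc L :=
  mobius A⁻¹ (f.eval RatFunc.C (mobius A RatFunc.X))

theorem mobius_mul_scalar (A : GL (Fin 2) L) (u : Lˣ) (h : RatFunc L) :
    mobius (A * Matrix.GeneralLinearGroup.scalar (Fin 2) u) h = mobius A h := by
  have key : ∀ i j, (A * Matrix.GeneralLinearGroup.scalar (Fin 2) u) i j = (u : L) * A i j := by
    intro i j
    simp [mul_comm]
  have hu : (RatFunc.C (u : L) : RatFunc L) ≠ 0 := by
    simp
  unfold mobius
  simp only [key, map_mul, mul_assoc, ← mul_add]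
  exact mul_div_mul_left _ _ hu

theorem conjGL_mul_scalar (A : GL (Fin 2) L) (u : Lˣ) (f : RatFunc L) :
    conjGL (A * Matrix.GeneralLinearGroup.scalar (Fin 2) u) f = conjGL A f := by
  have h : (A * Matrix.GeneralLinearGroup.scalar (Fin 2) u)⁻¹ =
      A⁻¹ * Matrix.GeneralLinearGroup.scalar (Fin 2) u⁻¹ := by
    have hc : Matrix.GeneralLinearGroup.scalar (Fin 2) u ∈ Subgroup.center (GL (Fin 2) L) := by
      rw [Matrix.GeneralLinearGroup.center_eq_range_scalar]
      exact ⟨u, rfl⟩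
    rw [mul_inv_rev, map_inv]
    exact (Subgroup.mem_center_iff.mp (Subgroup.inv_mem _ hc) A⁻¹).symm
  unfold conjGL
  rw [h, mobius_mul_scalar, mobius_mul_scalar]

/-- The conjugate `f ^ ρ = ρ⁻¹ ∘ f ∘ ρ` of `f` by an element `ρ` of `PGL₂(L)`. -/
noncomputable def conj (ρ : PGL(2, L)) (f : RatFunc L) : RatFunc L :=
  Quotient.lift (s := QuotientGroup.leftRel (Subgroup.center (GL (Fin 2) L)))
    (fun A => conjGL A f)
    (fun A B hAB => by
      have h : (Matrix.ProjGenLinGroup.mk A : PGL(2, L)) = Matrix.ProjGenLinGroup.mk B :=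
        Quotient.sound (s := QuotientGroup.leftRel (Subgroup.center (GL (Fin 2) L))) hAB
      obtain ⟨u, hu⟩ := Matrix.ProjGenLinGroup.mk_eq_mk_iff.mp h
      change conjGL A f = conjGL B f
      rw [← hu, conjGL_mul_scalar]) ρ

theorem conj_mk (A : GL (Fin 2) L) (f : RatFunc L) :
    conj (Matrix.ProjGenLinGroup.mk A) f = conjGL A f := rfl

/-- The action of `PGL₂(L)` on `ℙ¹(L)` by Möbius transformations. -/
noncomputable def act (ρ : PGL(2, L)) (P : OnePoint L) : OnePoint L :=
  (OnePoint.equivProjectivization L).symm (ρ • OnePoint.equivProjectivization L P)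

theorem act_mk (A : GL (Fin 2) L) (P : OnePoint L) :
    act (Matrix.ProjGenLinGroup.mk A) P = A • P := rfl

/-- The (underlying set of the) automorphism group of `f`: all `α` in `PGL₂(L)` that fix `f` under
conjugation. -/
def Aut (f : RatFunc L) : Set PGL(2, L) := {α | conj α f = f}

/-- Fixed-point multiplier form: at least three distinct fixed points, and every fixed point is
equal to its multiplier (so `∞` is not a fixed point). -/
def IsFixedPointMultiplierForm (f : RatFunc L) : Prop :=
  3 ≤ (Fix f).ncard ∧ ∀ P ∈ Fix f, P = ((multiplier f P : L) : OnePoint L)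

/-- Partial fixed-point multiplier form: there are at most three fixed points and each of them is
equal to its multiplier, or there are four fixed points and at least three of them are equal to
their multipliers. -/
def IsPartialFixedPointMultiplierForm (f : RatFunc L) : Prop :=
  ((Fix f).ncard ≤ 3 ∧ ∀ P ∈ Fix f, P = ((multiplier f P : L) : OnePoint L)) ∨
  ((Fix f).ncard = 4 ∧ 3 ≤ {P ∈ Fix f | P = ((multiplier f P : L) : OnePoint L)}.ncard)

end Field

section Galois

variable (K : Type*) {L : Type*} [Field K] [Field L] [Algebra K L]

/-- `f` is defined over `K`: it is a quotient of two polynomials with coefficients in `K`. -/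
def IsDefinedOver (f : RatFunc L) : Prop :=
  ∃ p q : K[X], q ≠ 0 ∧
    f = algebraMap L[X] (RatFunc L) (p.map (algebraMap K L)) /
      algebraMap L[X] (RatFunc L) (q.map (algebraMap K L))

/-- The action of an automorphism of `L` over `K` on `ℙ¹(L)`; it fixes `∞`. -/
def galAct {K : Type*} {L : Type*} [Field K] [Field L] [Algebra K L] (σ : L ≃ₐ[K] L) :
    OnePoint L → OnePoint L :=
  OnePoint.map σ

/-- A set of points of `ℙ¹(L)` that is mapped onto itself by every automorphism of `L` over `K`. -/
def IsGaloisInvariant (S : Set (OnePoint L)) : Prop :=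
  ∀ σ : L ≃ₐ[K] L, galAct σ '' S = S

/-- `g` is the degree 3 rational function over `K` in fixed-point multiplier form whose fixed
points are `x₁, x₂, x₃, x₄`, for four distinct elements `xᵢ ≠ 1` of `L` that form a Galois-invariant
set and satisfy `∑ 1 / (1 - xᵢ) = 1`. -/
def IsFourPointMap (g : RatFunc L) : Prop :=
  ∃ x : Fin 4 → L, Function.Injective x ∧ (∀ i, x i ≠ 1) ∧
    IsGaloisInvariant K (Set.range fun i => (x i : OnePoint L)) ∧
    ∑ i, 1 / (1 - x i) = 1 ∧
    deg g = 3 ∧ IsDefinedOver K g ∧ IsFixedPointMultiplierForm g ∧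
    Fix g = Set.range fun i => (x i : OnePoint L)

end Galois

end RatMap

/-!
Lift a cubic rational function `f = p / q` to the pair `(P, Q)` of binary cubic forms obtained by
homogenizing `p` and `q`. The fixed points of `f` are the eigenlines of the lift `(P, Q)`, and at an
eigenvector `v` with `(P, Q)(v) = c v` the multiplier is `tr D(P, Q)(v) / c - 3`
(`IsLift.multiplier_coords`). Both descriptions are visibly invariant under linear changes of
coordinates and equivariant under Galois, at infinity as well as at finite points, so conjugation by
`A` carries `Fix f` and its multipliers along (`mem_fix_conjGL`, `multiplier_conjGL`), and for `f`
over `K` a conjugate `f ^ A` is defined over `K` exactly when `f ^ σ(A) = f ^ A` for all Galois `σ`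
(`isDefinedOver_conjGL_iff`). The last condition says that each `σ(A) A⁻¹` is an automorphism of
`f`.

A conjugation into partial multiplier form is a matrix `A` with `A • multiplier f p = p` for enough
fixed points `p`; in particular these have distinct multipliers. A projective transformation is
determined by three values, so Galois acts on `A` the way it acts on the chosen fixed points.

If `f` has at most three fixed points with distinct multipliers, or a Galois-invariant set of three
of them is given, interpolating the pairs (multiplier, fixed point), together with pairs of points
of `K` if there are fewer than three, produces an `A` with `σ(A) = A` in `PGL₂`
(`exists_normalizing_of_invariant`). If instead an automorphism `α` exchanges two of four fixed
points and Galois permutes these two, interpolating at the three fixed points that remain after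
leaving out one of this pair gives `σ(A) = A` or `σ(A) = α A`, which is just as good
(`exists_normalizing_of_aut`).

Conversely, let `f ^ A` be in partial multiplier form and defined over `K`, with four fixed points.
If all four are moved to their multipliers, the multipliers are the `xᵢ` of the third alternative;
`∑ 1 / (1 - xᵢ) = 1` is Lagrange interpolation for `q` at the roots of `z q - p`
(`sum_one_div_one_sub_multiplier`). Otherwise the three normalized fixed points are
Galois-invariant, unless some `σ(A) A⁻¹` is a nontrivial automorphism. Automorphisms preserve
multipliers, so the latter can only exchange the fourth fixed point with the unique other one of
equal multiplier, which makes it the only nontrivial automorphism (`invariant_or_aut`).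
-/

namespace RatMap

/-! ### Lifts to binary cubic forms -/

section Lift

variable {L : Type*} [Field L]

/-- The binary cubic form `a x³ + b x² y + c x y² + d y³` obtained by homogenizing a cubic. -/
def hom (P : Cubic L) (x y : L) : L :=
  P.a * x ^ 3 + P.b * x ^ 2 * y + P.c * x * y ^ 2 + P.d * y ^ 3

/-- The trace `∂P/∂x + ∂Q/∂y` of the derivative of the self-map `(P, Q)` of the plane. -/
def trace (P Q : Cubic L) (x y : L) : L :=
  (3 * P.a * x ^ 2 + 2 * P.b * x * y + P.c * y ^ 2) +
    (Q.b * x ^ 2 + 2 * Q.c * x * y + 3 * Q.d * y ^ 2)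

/-- The quartic form `y P(x, y) - x Q(x, y)`, whose zeros are the fixed points of `P / Q`. -/
def fixForm (P Q : Cubic L) (x y : L) : L :=
  hom P x y * y - hom Q x y * x

/-- Homogeneous coordinates of a point of the projective line, normalized to be `(1, 0)` or
`(x, 1)`. -/
def coords : OnePoint L → L × L
  | ∞ => (1, 0)
  | (x : L) => (x, 1)

@[simp] theorem coords_infty : coords (∞ : OnePoint L) = (1, 0) := rfl

@[simp] theorem coords_coe (x : L) : coords (x : OnePoint L) = (x, 1) := rfl

/-- `P` and `Q` are a lift of the rational function `f` to a pair of binary cubic forms without a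
common zero. Over an algebraically closed field such a lift exists exactly when `f` has degree
three. -/
structure IsLift (f : RatFunc L) (P Q : Cubic L) : Prop where
  ne_zero : Q ≠ 0
  mul_eq : f * algebraMap L[X] (RatFunc L) Q.toPoly = algebraMap L[X] (RatFunc L) P.toPoly
  nondeg : ∀ x y, hom P x y = 0 → hom Q x y = 0 → x = 0 ∧ y = 0

theorem hom_smul (P : Cubic L) (t x y : L) : hom P (t * x) (t * y) = t ^ 3 * hom P x y := by
  unfold hom; ring

theorem fixForm_smul (P Q : Cubic L) (t x y : L) :
    fixForm P Q (t * x) (t * y) = t ^ 4 * fixForm P Q x y := by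
  unfold fixForm hom; ring

theorem trace_smul (P Q : Cubic L) (t x y : L) :
    trace P Q (t * x) (t * y) = t ^ 2 * trace P Q x y := by
  unfold trace; ring

theorem eval_toPoly (P : Cubic L) (x : L) : P.toPoly.eval x = hom P x 1 := by
  simp [Cubic.toPoly, hom]

theorem hom_one_zero (P : Cubic L) : hom P 1 0 = P.a := by simp [hom]

theorem natDegree_toPoly_le (P : Cubic L) : P.toPoly.natDegree ≤ 3 :=
  natDegree_cubic_le

theorem exists_toPoly_eq {p : L[X]} (hp : p.natDegree ≤ 3) : ∃ P : Cubic L, P.toPoly = p :=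
  ⟨Cubic.equiv.symm ⟨p, degree_le_of_natDegree_le hp⟩,
    congrArg Subtype.val (Cubic.equiv.apply_symm_apply (⟨p, _⟩ : {p : L[X] // p.degree ≤ 3}))⟩

theorem algebraMap_ne_zero {p : L[X]} (hp : p ≠ 0) : algebraMap L[X] (RatFunc L) p ≠ 0 :=
  (map_ne_zero_iff _ (RatFunc.algebraMap_injective L)).mpr hp

theorem IsLift.toPoly_ne_zero {f : RatFunc L} {P Q : Cubic L} (h : IsLift f P Q) :
    Q.toPoly ≠ 0 :=
  fun hQ => h.ne_zero ((Cubic.toPoly_eq_zero_iff Q).mp hQ)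

theorem IsLift.eq_div {f : RatFunc L} {P Q : Cubic L} (h : IsLift f P Q) :
    f = algebraMap L[X] (RatFunc L) P.toPoly / algebraMap L[X] (RatFunc L) Q.toPoly :=
  (eq_div_iff (algebraMap_ne_zero h.toPoly_ne_zero)).mpr h.mul_eq

theorem IsLift.unique {f g : RatFunc L} {P Q : Cubic L} (hf : IsLift f P Q) (hg : IsLift g P Q) :
    f = g := hf.eq_div.trans hg.eq_div.symm

/-- Two fractions representing `f` differ by a common factor from the reduced one. -/
theorem exists_eq_mul {f : RatFunc L} {p q : L[X]} (hq : q ≠ 0)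
    (h : f * algebraMap L[X] (RatFunc L) q = algebraMap L[X] (RatFunc L) p) :
    ∃ k : L[X], k ≠ 0 ∧ p = f.num * k ∧ q = f.denom * k := by
  have hf : f = algebraMap L[X] (RatFunc L) p / algebraMap L[X] (RatFunc L) q :=
    (eq_div_iff (algebraMap_ne_zero hq)).mpr h
  obtain ⟨k, rfl⟩ := (RatFunc.denom_dvd hq).mpr ⟨p, hf⟩
  refine ⟨k, right_ne_zero_of_mul hq, ?_, rfl⟩
  have := (RatFunc.num_mul_eq_mul_denom_iff hq).mpr hf
  apply mul_right_cancel₀ (RatFunc.denom_ne_zero f)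
  rw [← this]; ring

/-- The homogenized numerator and denominator have no common zero: a finite one would contradict
coprimality, and one at infinity would bring the degree below three. -/
theorem exists_isLift {f : RatFunc L} (hdeg : deg f = 3) : ∃ P Q, IsLift f P Q := by
  obtain ⟨P, hP⟩ := exists_toPoly_eq (le_trans (le_max_left _ _) hdeg.le : f.num.natDegree ≤ 3)
  obtain ⟨Q, hQ⟩ := exists_toPoly_eq (le_trans (le_max_right _ _) hdeg.le : f.denom.natDegree ≤ 3)
  refine ⟨P, Q, ?_, ?_, ?_⟩
  · rintro rfl
    exact RatFunc.denom_ne_zero f (by rw [← hQ, Cubic.zero])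
  · rw [hP, hQ]
    exact ((div_eq_iff (algebraMap_ne_zero (RatFunc.denom_ne_zero f))).mp
      (RatFunc.num_div_denom f)).symm
  · intro x y h1 h2
    by_cases hy : y = 0
    · subst hy
      refine ⟨?_, rfl⟩
      by_contra hx
      have ha : P.a = 0 := by simpa [hom, hx] using h1
      have hb : Q.a = 0 := by simpa [hom, hx] using h2
      have d1 : f.num.natDegree ≤ 2 := by
        rw [← hP, Cubic.of_a_eq_zero ha]; exact natDegree_quadratic_le
      have d2 : f.denom.natDegree ≤ 2 := by
        rw [← hQ, Cubic.of_a_eq_zero hb]; exact natDegree_quadratic_le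
      have := max_le d1 d2
      unfold deg at hdeg
      omega
    · exfalso
      have key : ∀ R : Cubic L, hom R x y = 0 → R.toPoly.eval (x / y) = 0 := by
        intro R hR
        have := hom_smul R y (x / y) 1
        rw [mul_div_cancel₀ _ hy, mul_one, hR] at this
        rw [eval_toPoly]
        simpa [hy] using this.symm
      obtain ⟨u, v, huv⟩ := RatFunc.isCoprime_num_denom f
      have := congrArg (Polynomial.eval (x / y)) huv
      rw [← hP, ← hQ] at this
      simp [key P h1, key Q h2] at this

theorem IsLift.deg_eq [IsAlgClosed L] {f : RatFunc L} {P Q : Cubic L} (h : IsLift f P Q) :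
    deg f = 3 := by
  obtain ⟨k, hk, h1, h2⟩ := exists_eq_mul h.toPoly_ne_zero h.mul_eq
  have hk0 : k.natDegree = 0 := by
    by_contra hd
    obtain ⟨x, hx⟩ := IsAlgClosed.exists_root k (by
      rw [degree_eq_natDegree hk]; exact_mod_cast hd)
    have e1 : hom P x 1 = 0 := by rw [← eval_toPoly, h1, eval_mul, hx.eq_zero, mul_zero]
    have e2 : hom Q x 1 = 0 := by rw [← eval_toPoly, h2, eval_mul, hx.eq_zero, mul_zero]
    exact one_ne_zero (h.nondeg x 1 e1 e2).2
  obtain ⟨c, rfl⟩ := natDegree_eq_zero.mp hk0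
  have hc : c ≠ 0 := by rintro rfl; simp at hk
  have n1 : f.num.natDegree = P.toPoly.natDegree := by rw [h1, natDegree_mul_C hc]
  have n2 : f.denom.natDegree = Q.toPoly.natDegree := by rw [h2, natDegree_mul_C hc]
  unfold deg
  rw [n1, n2]
  refine le_antisymm (max_le (natDegree_toPoly_le P) (natDegree_toPoly_le Q)) ?_
  by_cases ha : P.a = 0
  · by_cases hb : Q.a = 0
    · exact absurd (h.nondeg 1 0 (by rwa [hom_one_zero]) (by rwa [hom_one_zero])).1 one_ne_zero
    · rw [Cubic.natDegree_of_a_ne_zero hb]; exact le_max_right _ _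
  · rw [Cubic.natDegree_of_a_ne_zero ha]; exact le_max_left _ _

/-! ### Fixed points and multipliers in homogeneous coordinates -/

/-- The value at `x` of a fraction whose denominator does not vanish at `x`, reduced or not. -/
theorem eval_of_mul_eq {f : RatFunc L} {p q : L[X]} {x : L} (hx : q.eval x ≠ 0)
    (h : f * algebraMap L[X] (RatFunc L) q = algebraMap L[X] (RatFunc L) p) :
    f.denom.eval x ≠ 0 ∧ f.num.eval x / f.denom.eval x = p.eval x / q.eval x := by
  obtain ⟨k, hk, rfl, rfl⟩ := exists_eq_mul (by rintro rfl; simp at hx) h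
  rw [eval_mul] at hx
  have h1 := left_ne_zero_of_mul hx
  have h2 := right_ne_zero_of_mul hx
  refine ⟨h1, ?_⟩
  rw [eval_mul, eval_mul]
  field_simp

theorem derivAt_of_mul_eq {f : RatFunc L} {p q : L[X]} {x : L} (hx : q.eval x ≠ 0)
    (h : f * algebraMap L[X] (RatFunc L) q = algebraMap L[X] (RatFunc L) p) :
    derivAt f x = (derivative p * q - p * derivative q).eval x / (q.eval x) ^ 2 := by
  obtain ⟨k, hk, rfl, rfl⟩ := exists_eq_mul (by rintro rfl; simp at hx) h
  rw [eval_mul] at hx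
  have h1 := left_ne_zero_of_mul hx
  have h2 := right_ne_zero_of_mul hx
  unfold derivAt
  simp only [derivative_mul, eval_mul, eval_sub, eval_add]
  field_simp
  ring

theorem IsLift.hom_ne_zero {f : RatFunc L} {P Q : Cubic L} (h : IsLift f P Q)
    (x : L) (hQ : hom Q x 1 = 0) : hom P x 1 ≠ 0 :=
  fun hP => one_ne_zero (h.nondeg x 1 hP hQ).2

/-- The binary cubic form `P(a x + b y, c x + d y)`. -/
def subst (P : Cubic L) (a b c d : L) : Cubic L where
  a := hom P a c
  b := 3 * P.a * a ^ 2 * b + P.b * (2 * a * b * c + a ^ 2 * d) +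
    P.c * (b * c ^ 2 + 2 * a * c * d) + 3 * P.d * c ^ 2 * d
  c := 3 * P.a * a * b ^ 2 + P.b * (b ^ 2 * c + 2 * a * b * d) +
    P.c * (a * d ^ 2 + 2 * b * c * d) + 3 * P.d * c * d ^ 2
  d := hom P b d

theorem hom_subst (P : Cubic L) (a b c d x y : L) :
    hom (subst P a b c d) x y = hom P (a * x + b * y) (c * x + d * y) := by
  simp only [hom, subst]; ring

theorem subst_ne_zero {P : Cubic L} (hP : P ≠ 0) {a b c d : L} (hdet : a * d - b * c ≠ 0) :
    subst P a b c d ≠ 0 := by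
  intro h
  -- substituting the adjugate matrix gives back `P` up to the cube of the determinant
  have key : subst (subst P a b c d) d (-b) (-c) a = ⟨(a * d - b * c) ^ 3 * P.a,
      (a * d - b * c) ^ 3 * P.b, (a * d - b * c) ^ 3 * P.c, (a * d - b * c) ^ 3 * P.d⟩ := by
    ext <;> simp only [subst, hom] <;> ring
  have h0 : subst (0 : Cubic L) d (-b) (-c) a = 0 := by
    ext <;> simp only [subst, hom, show (0 : Cubic L) = ⟨0, 0, 0, 0⟩ from rfl] <;> ring
  rw [h, h0] at key
  have hd := pow_ne_zero 3 hdet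
  apply hP
  ext
  · exact (mul_eq_zero.mp (congrArg Cubic.a key).symm).resolve_left hd
  · exact (mul_eq_zero.mp (congrArg Cubic.b key).symm).resolve_left hd
  · exact (mul_eq_zero.mp (congrArg Cubic.c key).symm).resolve_left hd
  · exact (mul_eq_zero.mp (congrArg Cubic.d key).symm).resolve_left hd

/-- Substituting a Möbius transformation into a cubic, after clearing denominators. -/
theorem eval₂_toPoly_div (P : Cubic L) (a b c d : L)
    (hD : RatFunc.C c * RatFunc.X + RatFunc.C d ≠ (0 : RatFunc L)) :
    P.toPoly.eval₂ RatFunc.C ((RatFunc.C a * RatFunc.X + RatFunc.C b) /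
        (RatFunc.C c * RatFunc.X + RatFunc.C d)) *
      (RatFunc.C c * RatFunc.X + RatFunc.C d) ^ 3 =
    algebraMap L[X] (RatFunc L) (subst P a b c d).toPoly := by
  simp only [Cubic.toPoly, eval₂_add, eval₂_mul, eval₂_C, eval₂_pow, eval₂_X, map_add, map_mul,
    map_pow, RatFunc.algebraMap_C, RatFunc.algebraMap_X, subst, hom, map_ofNat]
  have aux : ∀ N D p q r s : RatFunc L, D ≠ 0 →
      (p * (N / D) ^ 3 + q * (N / D) ^ 2 + r * (N / D) + s) * D ^ 3 =
        p * N ^ 3 + q * N ^ 2 * D + r * N * D ^ 2 + s * D ^ 3 := by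
    intro N D p q r s hD
    field_simp
  rw [aux _ _ _ _ _ _ hD]
  ring

theorem IsLift.eval_mobius {f : RatFunc L} {P Q : Cubic L} (h : IsLift f P Q) {a b c d : L}
    (hdet : a * d - b * c ≠ 0) :
    f.eval RatFunc.C ((RatFunc.C a * RatFunc.X + RatFunc.C b) /
        (RatFunc.C c * RatFunc.X + RatFunc.C d)) *
      algebraMap L[X] (RatFunc L) (subst Q a b c d).toPoly =
    algebraMap L[X] (RatFunc L) (subst P a b c d).toPoly := by
  have hD : RatFunc.C c * RatFunc.X + RatFunc.C d ≠ (0 : RatFunc L) := by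
    rw [← RatFunc.algebraMap_C, ← RatFunc.algebraMap_C, ← RatFunc.algebraMap_X, ← map_mul,
      ← map_add]
    apply algebraMap_ne_zero
    intro h0
    have h1 := congrArg (fun p => coeff p 1) h0
    have h2 := congrArg (fun p => coeff p 0) h0
    simp at h1 h2
    simp [h1, h2] at hdet
  obtain ⟨k, hk, h1, h2⟩ := exists_eq_mul h.toPoly_ne_zero h.mul_eq
  have hne : algebraMap L[X] (RatFunc L) (subst Q a b c d).toPoly ≠ 0 :=
    algebraMap_ne_zero fun h0 =>
      subst_ne_zero h.ne_zero hdet ((Cubic.toPoly_eq_zero_iff _).mp h0)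
  rw [← eval₂_toPoly_div Q a b c d hD, h2, eval₂_mul] at hne ⊢
  rw [← eval₂_toPoly_div P a b c d hD, h1, eval₂_mul, RatFunc.eval]
  have aux : ∀ n e k d : RatFunc L, e ≠ 0 → n / e * (e * k * d) = n * k * d := by
    intro n e k d he
    field_simp
  exact aux _ _ _ _ (left_ne_zero_of_mul (left_ne_zero_of_mul hne))

theorem coords_ne_zero (pt : OnePoint L) : ¬ ((coords pt).1 = 0 ∧ (coords pt).2 = 0) := by
  cases pt <;> simp

theorem IsLift.onP1_coe {f : RatFunc L} {P Q : Cubic L} (h : IsLift f P Q) (x : L) :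
    onP1 f x = if hom Q x 1 = 0 then ∞ else ((hom P x 1 / hom Q x 1 : L) : OnePoint L) := by
  change (if f.denom.eval x = 0 then ∞
      else ((f.num.eval x / f.denom.eval x : L) : OnePoint L)) = _
  by_cases hQ : hom Q x 1 = 0
  · have hP := h.hom_ne_zero x hQ
    obtain ⟨k, hk, h1, h2⟩ := exists_eq_mul h.toPoly_ne_zero h.mul_eq
    rw [← eval_toPoly, h1, eval_mul] at hP
    rw [← eval_toPoly, h2, eval_mul] at hQ
    rw [← eval_toPoly Q, h2, eval_mul, if_pos hQ,
      if_pos ((mul_eq_zero.mp hQ).resolve_right (right_ne_zero_of_mul hP))]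
  · have := eval_of_mul_eq (by rwa [eval_toPoly]) h.mul_eq
    rw [if_neg this.1, if_neg hQ, this.2, eval_toPoly, eval_toPoly]

theorem IsLift.onP1_infty {f : RatFunc L} {P Q : Cubic L} (h : IsLift f P Q) :
    onP1 f ∞ = ∞ ↔ Q.a = 0 := by
  change (if f.denom.natDegree < f.num.natDegree then ∞
      else ((f.num.coeff f.denom.natDegree / f.denom.leadingCoeff : L) : OnePoint L)) = ∞ ↔ _
  obtain ⟨k, hk, h1, h2⟩ := exists_eq_mul h.toPoly_ne_zero h.mul_eq
  have hQd : Q.toPoly.natDegree = f.denom.natDegree + k.natDegree := by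
    rw [h2, natDegree_mul (RatFunc.denom_ne_zero f) hk]
  have hlt : f.denom.natDegree < f.num.natDegree ↔ Q.a = 0 := by
    by_cases hf : f.num = 0
    · have hP : P.a = 0 := by rw [← Cubic.coeff_eq_a (P := P), h1, hf]; simp
      have hQ : Q.a ≠ 0 := fun hQ =>
        one_ne_zero (h.nondeg 1 0 (by rwa [hom_one_zero]) (by rwa [hom_one_zero])).1
      simp [hf, hQ]
    have hPd : P.toPoly.natDegree = f.num.natDegree + k.natDegree := by
      rw [h1, natDegree_mul hf hk]
    by_cases hQ : Q.a = 0
    · have hP : P.a ≠ 0 := fun hP =>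
        one_ne_zero (h.nondeg 1 0 (by rwa [hom_one_zero]) (by rwa [hom_one_zero])).1
      have e1 := Cubic.natDegree_of_a_ne_zero hP
      have e2 : Q.toPoly.natDegree ≤ 2 := by
        rw [Cubic.of_a_eq_zero hQ]; exact natDegree_quadratic_le
      simp only [hQ, iff_true]
      omega
    · have e1 := Cubic.natDegree_of_a_ne_zero hQ
      have e2 := natDegree_toPoly_le P
      simp only [hQ, iff_false]
      omega
  rw [← hlt]
  split_ifs with hc <;> simp [hc]

theorem IsLift.mem_fix {f : RatFunc L} {P Q : Cubic L} (h : IsLift f P Q) (pt : OnePoint L) :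
    pt ∈ Fix f ↔ fixForm P Q (coords pt).1 (coords pt).2 = 0 := by
  change onP1 f pt = pt ↔ _
  cases pt with
  | infty => rw [h.onP1_infty]; simp [fixForm, hom]
  | coe x =>
    rw [h.onP1_coe]
    by_cases hQ : hom Q x 1 = 0
    · simp [fixForm, hQ, h.hom_ne_zero x hQ]
    · simp only [fixForm, coords_coe, hQ, if_false, OnePoint.coe_eq_coe]
      rw [div_eq_iff hQ, mul_one, sub_eq_zero, mul_comm]

/-- A zero of the fixed-point form is an eigenvector of the lift, with a nonzero eigenvalue. -/
theorem IsLift.exists_eigenvalue {f : RatFunc L} {P Q : Cubic L} (h : IsLift f P Q) {x y : L}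
    (hxy : ¬ (x = 0 ∧ y = 0)) (hfix : fixForm P Q x y = 0) :
    ∃ c, c ≠ 0 ∧ hom P x y = c * x ∧ hom Q x y = c * y := by
  unfold fixForm at hfix
  have key : ∀ c, hom P x y = c * x → hom Q x y = c * y →
      ∃ c, c ≠ 0 ∧ hom P x y = c * x ∧ hom Q x y = c * y := by
    intro c h1 h2
    refine ⟨c, ?_, h1, h2⟩
    rintro rfl
    exact hxy (h.nondeg x y (by simpa using h1) (by simpa using h2))
  by_cases hx : x = 0
  · have hy : y ≠ 0 := fun hy => hxy ⟨hx, hy⟩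
    exact key (hom Q x y / y) (by field_simp; linear_combination hfix)
      (by field_simp)
  · exact key (hom P x y / x) (by field_simp) (by field_simp; linear_combination -hfix)

/-- The multiplier at the fixed point spanned by an eigenvector `v` of the lift, with eigenvalue
`c`. By Euler's formula the derivative of the lift at `v` has `v` as an eigenvector of eigenvalue `3
c`, and its other eigenvalue is `c` times the multiplier. -/
theorem IsLift.multiplier_coords {f : RatFunc L} {P Q : Cubic L} (h : IsLift f P Q)
    {pt : OnePoint L} {c : L} (hc : c ≠ 0)
    (h1 : hom P (coords pt).1 (coords pt).2 = c * (coords pt).1)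
    (h2 : hom Q (coords pt).1 (coords pt).2 = c * (coords pt).2) :
    multiplier f pt = trace P Q (coords pt).1 (coords pt).2 / c - 3 := by
  cases pt with
  | infty =>
    change derivAt (f.eval RatFunc.C (RatFunc.X⁻¹ : RatFunc L))⁻¹ 0 = _
    simp only [coords_infty, mul_one, mul_zero, hom_one_zero] at h1 h2 ⊢
    -- the lift of `f (1 / z)`, whose inverse is differentiated at `0`
    have hQ := h.eval_mobius (a := 0) (b := 1) (c := 1) (d := 0) (by simp)
    simp only [map_zero, map_one, zero_mul, one_mul, zero_add, add_zero, one_div] at hQ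
    have hP0 : algebraMap L[X] (RatFunc L) (subst P 0 1 1 0).toPoly ≠ 0 := by
      refine algebraMap_ne_zero fun h0 => ?_
      have := congrArg (eval 0) h0
      rw [eval_toPoly] at this
      simp [hom, subst, h1, hc] at this
    rw [derivAt_of_mul_eq (p := (subst Q 0 1 1 0).toPoly) (q := (subst P 0 1 1 0).toPoly)]
    · simp [Cubic.toPoly, subst, hom, h1, h2, trace]
      field_simp
      ring
    · rw [eval_toPoly]
      simpa [hom, subst, h1] using hc
    · rw [← hQ] at hP0 ⊢
      rw [← mul_assoc, inv_mul_cancel₀ (left_ne_zero_of_mul hP0), one_mul]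
  | coe x =>
    change derivAt f x = _
    simp only [coords_coe, mul_one] at h1 h2 ⊢
    rw [derivAt_of_mul_eq (by rw [eval_toPoly, h2]; exact hc) h.mul_eq]
    simp only [eval_sub, eval_mul, eval_toPoly, h1, h2]
    simp only [Cubic.toPoly, derivative_add, derivative_C_mul, derivative_X_pow, derivative_C,
      derivative_X, eval_add, eval_mul, eval_C, eval_pow, eval_X, trace,
      Nat.cast_ofNat]
    simp only [hom] at h1 h2
    field_simp
    simp
    linear_combination (-3) * h2

/-! ### Conjugation -/

theorem det_fin_two_ne_zero (A : GL (Fin 2) L) : A 0 0 * A 1 1 - A 0 1 * A 1 0 ≠ 0 := by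
  rw [← Matrix.det_fin_two]; exact A.det_ne_zero

/-- The action of `A` on the projective line, read in homogeneous coordinates. -/
theorem coords_smul (A : GL (Fin 2) L) (pt : OnePoint L) : ∃ t, t ≠ 0 ∧
    A 0 0 * (coords pt).1 + A 0 1 * (coords pt).2 = t * (coords (A • pt)).1 ∧
    A 1 0 * (coords pt).1 + A 1 1 * (coords pt).2 = t * (coords (A • pt)).2 := by
  have hdet := det_fin_two_ne_zero A
  cases pt with
  | infty =>
    rw [smul_infty_eq_ite]
    by_cases h : A 1 0 = 0
    · refine ⟨A 0 0, fun h0 => hdet (by rw [h, h0]; ring), ?_⟩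
      simp [h]
    · refine ⟨A 1 0, h, ?_⟩
      simp [h]
      field_simp
  | coe x =>
    rw [smul_some_eq_ite]
    by_cases h : A 1 0 * x + A 1 1 = 0
    · refine ⟨A 0 0 * x + A 0 1, fun h0 => hdet ?_, ?_⟩
      · by_cases hc : A 1 0 = 0
        · have : A 1 1 = 0 := by simpa [hc] using h
          rw [hc, this]; ring
        · have h1 : A 1 0 * (A 0 0 * A 1 1 - A 0 1 * A 1 0) = 0 := by
            linear_combination A 1 0 * A 0 0 * h - A 1 0 * A 1 0 * h0
          exact (mul_eq_zero.mp h1).resolve_left hc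
      · simp [h]
    · refine ⟨A 1 0 * x + A 1 1, h, ?_⟩
      simp [h, mul_div_cancel₀]

/-- The first component of `adj(A) ∘ (P, Q) ∘ A`, a lift of the conjugate map. -/
def conjFst (A : GL (Fin 2) L) (P Q : Cubic L) : Cubic L :=
  let P' := subst P (A 0 0) (A 0 1) (A 1 0) (A 1 1)
  let Q' := subst Q (A 0 0) (A 0 1) (A 1 0) (A 1 1)
  ⟨A 1 1 * P'.a - A 0 1 * Q'.a, A 1 1 * P'.b - A 0 1 * Q'.b, A 1 1 * P'.c - A 0 1 * Q'.c,
    A 1 1 * P'.d - A 0 1 * Q'.d⟩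

/-- The second component of `adj(A) ∘ (P, Q) ∘ A`. -/
def conjSnd (A : GL (Fin 2) L) (P Q : Cubic L) : Cubic L :=
  let P' := subst P (A 0 0) (A 0 1) (A 1 0) (A 1 1)
  let Q' := subst Q (A 0 0) (A 0 1) (A 1 0) (A 1 1)
  ⟨A 0 0 * Q'.a - A 1 0 * P'.a, A 0 0 * Q'.b - A 1 0 * P'.b, A 0 0 * Q'.c - A 1 0 * P'.c,
    A 0 0 * Q'.d - A 1 0 * P'.d⟩

theorem hom_conjFst (A : GL (Fin 2) L) (P Q : Cubic L) (x y : L) :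
    hom (conjFst A P Q) x y =
      A 1 1 * hom P (A 0 0 * x + A 0 1 * y) (A 1 0 * x + A 1 1 * y) -
        A 0 1 * hom Q (A 0 0 * x + A 0 1 * y) (A 1 0 * x + A 1 1 * y) := by
  rw [← hom_subst, ← hom_subst]; simp only [conjFst, hom]; ring

theorem hom_conjSnd (A : GL (Fin 2) L) (P Q : Cubic L) (x y : L) :
    hom (conjSnd A P Q) x y =
      A 0 0 * hom Q (A 0 0 * x + A 0 1 * y) (A 1 0 * x + A 1 1 * y) -
        A 1 0 * hom P (A 0 0 * x + A 0 1 * y) (A 1 0 * x + A 1 1 * y) := by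
  rw [← hom_subst, ← hom_subst]; simp only [conjSnd, hom]; ring

theorem fixForm_conj (A : GL (Fin 2) L) (P Q : Cubic L) (x y : L) :
    fixForm (conjFst A P Q) (conjSnd A P Q) x y =
      fixForm P Q (A 0 0 * x + A 0 1 * y) (A 1 0 * x + A 1 1 * y) := by
  simp only [fixForm, hom_conjFst, hom_conjSnd]; ring

theorem trace_conj (A : GL (Fin 2) L) (P Q : Cubic L) (x y : L) :
    trace (conjFst A P Q) (conjSnd A P Q) x y = (A 0 0 * A 1 1 - A 0 1 * A 1 0) *
      trace P Q (A 0 0 * x + A 0 1 * y) (A 1 0 * x + A 1 1 * y) := by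
  simp only [trace, conjFst, conjSnd, subst, hom]; ring

theorem exists_hom_eq_zero [IsAlgClosed L] (P : Cubic L) :
    ∃ x y, ¬ (x = 0 ∧ y = 0) ∧ hom P x y = 0 := by
  by_cases ha : P.a = 0
  · exact ⟨1, 0, by simp, by rwa [hom_one_zero]⟩
  · obtain ⟨x, hx⟩ := IsAlgClosed.exists_root P.toPoly (by
      rw [Cubic.degree_of_a_ne_zero ha]; decide)
    exact ⟨x, 1, by simp, by rw [← eval_toPoly]; exact hx⟩

/-- The lift of a conjugate; algebraic closedness ensures that its denominator does not vanish. -/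
theorem IsLift.conj [IsAlgClosed L] {f : RatFunc L} {P Q : Cubic L} (h : IsLift f P Q)
    (A : GL (Fin 2) L) : IsLift (conjGL A f) (conjFst A P Q) (conjSnd A P Q) := by
  have hdet := det_fin_two_ne_zero A
  have nd : ∀ x y, hom (conjFst A P Q) x y = 0 → hom (conjSnd A P Q) x y = 0 → x = 0 ∧ y = 0 := by
    intro x y h1 h2
    rw [hom_conjFst] at h1
    rw [hom_conjSnd] at h2
    obtain ⟨e1, e2⟩ := h.nondeg (A 0 0 * x + A 0 1 * y) (A 1 0 * x + A 1 1 * y)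
      (mul_left_cancel₀ hdet (by linear_combination A 0 0 * h1 + A 0 1 * h2))
      (mul_left_cancel₀ hdet (by linear_combination A 1 0 * h1 + A 1 1 * h2))
    exact ⟨mul_left_cancel₀ hdet (by linear_combination A 1 1 * e1 - A 0 1 * e2),
      mul_left_cancel₀ hdet (by linear_combination A 0 0 * e2 - A 1 0 * e1)⟩
  have hne : conjSnd A P Q ≠ 0 := by
    intro h0
    obtain ⟨x, y, hxy, hP⟩ := exists_hom_eq_zero (conjFst A P Q)
    exact hxy (nd x y hP (by
      rw [h0]; simp only [hom, show (0 : Cubic L) = ⟨0, 0, 0, 0⟩ from rfl]; ring))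
  refine ⟨hne, ?_, nd⟩
  have hS : (conjSnd A P Q).toPoly ≠ 0 := fun h0 => hne ((Cubic.toPoly_eq_zero_iff _).mp h0)
  have hS' := algebraMap_ne_zero hS
  have hev := h.eval_mobius hdet
  set P' := subst P (A 0 0) (A 0 1) (A 1 0) (A 1 1) with hP'
  set Q' := subst Q (A 0 0) (A 0 1) (A 1 0) (A 1 1) with hQ'
  have e1 : algebraMap L[X] (RatFunc L) (conjFst A P Q).toPoly =
      RatFunc.C (A 1 1) * algebraMap L[X] (RatFunc L) P'.toPoly -
        RatFunc.C (A 0 1) * algebraMap L[X] (RatFunc L) Q'.toPoly := by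
    rw [← RatFunc.algebraMap_C, ← RatFunc.algebraMap_C, ← map_mul, ← map_mul, ← map_sub]
    congr 1
    simp only [Cubic.toPoly, conjFst, ← hP', ← hQ', map_sub, map_mul]
    ring
  have e2 : algebraMap L[X] (RatFunc L) (conjSnd A P Q).toPoly =
      RatFunc.C (A 0 0) * algebraMap L[X] (RatFunc L) Q'.toPoly -
        RatFunc.C (A 1 0) * algebraMap L[X] (RatFunc L) P'.toPoly := by
    rw [← RatFunc.algebraMap_C, ← RatFunc.algebraMap_C, ← map_mul, ← map_mul, ← map_sub]
    congr 1
    simp only [Cubic.toPoly, conjSnd, ← hP', ← hQ', map_sub, map_mul]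
    ring
  rw [e2] at hS'
  rw [e1, e2, conjGL]
  have hm : mobius A RatFunc.X = (RatFunc.C (A 0 0) * RatFunc.X + RatFunc.C (A 0 1)) /
      (RatFunc.C (A 1 0) * RatFunc.X + RatFunc.C (A 1 1)) := rfl
  rw [hm]
  set h := f.eval RatFunc.C ((RatFunc.C (A 0 0) * RatFunc.X + RatFunc.C (A 0 1)) /
      (RatFunc.C (A 1 0) * RatFunc.X + RatFunc.C (A 1 1)))
  rw [← hev] at hS' ⊢
  have hinv : ∀ i j, A⁻¹ i j = (A 0 0 * A 1 1 - A 0 1 * A 1 0)⁻¹ *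
      (Matrix.adjugate A.1) i j := by
    intro i j
    rw [Matrix.coe_units_inv, Matrix.inv_def, Matrix.smul_apply, smul_eq_mul,
      Ring.inverse_eq_inv', Matrix.det_fin_two]
  have hu : RatFunc.C (A 0 0 * A 1 1 - A 0 1 * A 1 0)⁻¹ ≠ (0 : RatFunc L) := by
    rw [_root_.map_ne_zero]; exact inv_ne_zero hdet
  have hden : -RatFunc.C (A 1 0) * h + RatFunc.C (A 0 0) ≠ 0 := by
    intro h0
    apply hS'
    linear_combination algebraMap L[X] (RatFunc L) Q'.toPoly * h0
  have : mobius A⁻¹ h = (RatFunc.C (A 1 1) * h - RatFunc.C (A 0 1)) /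
      (-RatFunc.C (A 1 0) * h + RatFunc.C (A 0 0)) := by
    unfold mobius
    rw [hinv, hinv, hinv, hinv, Matrix.adjugate_fin_two]
    simp only [Matrix.of_apply, Matrix.cons_val', Matrix.cons_val_zero, Matrix.cons_val_one,
      Matrix.cons_val_fin_one, map_mul, map_neg]
    conv_rhs => rw [← mul_div_mul_left _ _ hu]
    congr 1 <;> ring
  rw [this, div_mul_eq_mul_div, div_eq_iff hden]
  ring

theorem conjFst_mul (A B : GL (Fin 2) L) (P Q : Cubic L) :
    conjFst (A * B) P Q = conjFst B (conjFst A P Q) (conjSnd A P Q) := by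
  ext <;> simp only [conjFst, conjSnd, subst, hom, Units.val_mul, Matrix.mul_apply,
    Fin.sum_univ_two] <;> ring

theorem conjSnd_mul (A B : GL (Fin 2) L) (P Q : Cubic L) :
    conjSnd (A * B) P Q = conjSnd B (conjFst A P Q) (conjSnd A P Q) := by
  ext <;> simp only [conjFst, conjSnd, subst, hom, Units.val_mul, Matrix.mul_apply,
    Fin.sum_univ_two] <;> ring

section AlgClosed

variable [IsAlgClosed L] {f : RatFunc L}

theorem conjGL_mul (hdeg : deg f = 3) (A B : GL (Fin 2) L) :
    conjGL (A * B) f = conjGL B (conjGL A f) := by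
  obtain ⟨P, Q, h⟩ := exists_isLift hdeg
  have h1 := h.conj (A * B)
  rw [conjFst_mul, conjSnd_mul] at h1
  exact h1.unique ((h.conj A).conj B)

theorem conjGL_one (hdeg : deg f = 3) : conjGL 1 f = f := by
  obtain ⟨P, Q, h⟩ := exists_isLift hdeg
  have h1 := h.conj 1
  have e1 : conjFst 1 P Q = P := by ext <;> simp [conjFst, subst, hom]
  have e2 : conjSnd 1 P Q = Q := by ext <;> simp [conjSnd, subst, hom]
  rw [e1, e2] at h1
  exact h1.unique h

theorem deg_conjGL (hdeg : deg f = 3) (A : GL (Fin 2) L) : deg (conjGL A f) = 3 := by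
  obtain ⟨P, Q, h⟩ := exists_isLift hdeg
  exact (h.conj A).deg_eq

theorem mem_fix_conjGL (hdeg : deg f = 3) (A : GL (Fin 2) L) (pt : OnePoint L) :
    pt ∈ Fix (conjGL A f) ↔ A • pt ∈ Fix f := by
  obtain ⟨P, Q, h⟩ := exists_isLift hdeg
  obtain ⟨t, ht, h1, h2⟩ := coords_smul A pt
  rw [(h.conj A).mem_fix, h.mem_fix, fixForm_conj, h1, h2, fixForm_smul]
  simp [ht]

/-- Multipliers are invariant under conjugation, because the trace of the derivative of a lift
is. -/
theorem multiplier_conjGL (hdeg : deg f = 3) (A : GL (Fin 2) L) {pt : OnePoint L}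
    (hpt : A • pt ∈ Fix f) : multiplier (conjGL A f) pt = multiplier f (A • pt) := by
  obtain ⟨P, Q, h⟩ := exists_isLift hdeg
  obtain ⟨t, ht, h1, h2⟩ := coords_smul A pt
  obtain ⟨c, hc, hP, hQ⟩ := h.exists_eigenvalue (coords_ne_zero _) ((h.mem_fix _).mp hpt)
  have hdet := det_fin_two_ne_zero A
  rw [h.multiplier_coords hc hP hQ, (h.conj A).multiplier_coords
    (c := (A 0 0 * A 1 1 - A 0 1 * A 1 0) * t ^ 2 * c), trace_conj, h1, h2, trace_smul]
  · field_simp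
  · simp [hdet, ht, hc]
  · rw [hom_conjFst, h1, h2, hom_smul, hom_smul, hP, hQ]
    linear_combination (-t ^ 2 * c * A 1 1) * h1 + t ^ 2 * c * A 0 1 * h2
  · rw [hom_conjSnd, h1, h2, hom_smul, hom_smul, hP, hQ]
    linear_combination (t ^ 2 * c * A 1 0) * h1 - t ^ 2 * c * A 0 0 * h2

end AlgClosed

end Lift

/-! ### The number of fixed points and the multiplier formula -/

section FixedPoints

variable {L : Type*} [Field L] {f : RatFunc L} {P Q : Cubic L}

/-- The polynomial `z q(z) - p(z)`, whose roots are the finite fixed points of `p / q`. -/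
noncomputable def fixPoly (P Q : Cubic L) : L[X] := X * Q.toPoly - P.toPoly

theorem IsLift.fixPoly_ne_zero (h : IsLift f P Q) (hdeg : deg f = 3) : fixPoly P Q ≠ 0 := by
  intro h0
  have hf : f = RatFunc.X := by
    apply mul_right_cancel₀ (algebraMap_ne_zero h.toPoly_ne_zero)
    rw [h.mul_eq, ← sub_eq_zero.mp h0, map_mul, RatFunc.algebraMap_X]
  rw [hf] at hdeg
  simp [deg] at hdeg

theorem IsLift.coe_mem_fix (h : IsLift f P Q) (x : L) :
    (x : OnePoint L) ∈ Fix f ↔ (fixPoly P Q).IsRoot x := by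
  rw [h.mem_fix, IsRoot.def, fixPoly, eval_sub, eval_mul, eval_X, eval_toPoly, eval_toPoly,
    fixForm, coords_coe, mul_one, mul_comm x, sub_eq_zero, sub_eq_zero, eq_comm]

theorem natDegree_fixPoly_le (P Q : Cubic L) : (fixPoly P Q).natDegree ≤ 4 := by
  refine (natDegree_sub_le _ _).trans (max_le ?_ ((natDegree_toPoly_le P).trans (by norm_num)))
  refine natDegree_mul_le.trans ?_
  have := natDegree_toPoly_le Q
  rw [natDegree_X]
  omega

/-- A fixed point at infinity costs one degree of the polynomial of the finite fixed points, so
there are at most four in all. -/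
theorem fix_finite_and_ncard_le (hdeg : deg f = 3) : (Fix f).Finite ∧ (Fix f).ncard ≤ 4 := by
  obtain ⟨P, Q, h⟩ := exists_isLift hdeg
  have hW := h.fixPoly_ne_zero hdeg
  set T : Finset (OnePoint L) := (fixPoly P Q).roots.toFinset.image (fun x : L => (x : OnePoint L))
  have hT : T.card ≤ (fixPoly P Q).natDegree :=
    Finset.card_image_le.trans ((Multiset.toFinset_card_le _).trans (card_roots' _))
  have hcoe : ∀ x : L, (x : OnePoint L) ∈ Fix f → (x : OnePoint L) ∈ T := fun x hx =>
    Finset.mem_image_of_mem _ (by simpa [hW] using (h.coe_mem_fix x).mp hx)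
  obtain ⟨U, hU, hUcard⟩ : ∃ U : Finset (OnePoint L), Fix f ⊆ U ∧ U.card ≤ 4 := by
    by_cases hinf : (∞ : OnePoint L) ∈ Fix f
    · refine ⟨insert ∞ T, ?_, ?_⟩
      · intro pt hpt
        cases pt with
        | infty => simp
        | coe x => simp [hcoe x hpt]
      · have hQ : Q.a = 0 := h.onP1_infty.mp hinf
        have : (fixPoly P Q).natDegree ≤ 3 := by
          refine (natDegree_sub_le _ _).trans (max_le ?_ (natDegree_toPoly_le P))
          refine natDegree_mul_le.trans ?_
          have : Q.toPoly.natDegree ≤ 2 := by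
            rw [Cubic.of_a_eq_zero hQ]; exact natDegree_quadratic_le
          rw [natDegree_X]
          omega
        have := Finset.card_insert_le (∞ : OnePoint L) T
        omega
    · refine ⟨T, ?_, hT.trans (natDegree_fixPoly_le P Q)⟩
      intro pt hpt
      cases pt with
      | infty => exact absurd hpt hinf
      | coe x => exact hcoe x hpt
  refine ⟨U.finite_toSet.subset hU, ?_⟩
  have := Set.ncard_le_ncard hU U.finite_toSet
  rw [Set.ncard_coe_finset] at this
  omega

/-- The multiplier formula for four distinct finite fixed points. Writing `F = z q - p`, the
quantity `1 / (1 - multiplier)` at a fixed point `x` is `q(x) / F'(x)`, and these sum to the ratio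
of the leading coefficients of `q` and `F` by Lagrange interpolation. -/
theorem sum_one_div_one_sub_multiplier (hdeg : deg f = 3) {x : Fin 4 → L}
    (hx : Function.Injective x) (hfix : Fix f = Set.range fun i => (x i : OnePoint L)) :
    (∀ i, multiplier f (x i) ≠ 1) ∧ ∑ i, 1 / (1 - multiplier f (x i)) = 1 := by
  obtain ⟨P, Q, h⟩ := exists_isLift hdeg
  have hQa : Q.a ≠ 0 := by
    intro hQ
    have : (∞ : OnePoint L) ∈ Fix f := h.onP1_infty.mpr hQ
    rw [hfix] at this
    obtain ⟨i, hi⟩ := this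
    exact OnePoint.coe_ne_infty _ hi
  have hroot : ∀ i, (fixPoly P Q).eval (x i) = 0 := fun i =>
    (h.coe_mem_fix (x i)).mp (hfix ▸ ⟨i, rfl⟩)
  have hF : fixPoly P Q = C Q.a * Lagrange.nodal Finset.univ x := by
    have hX : (X * Q.toPoly).degree = 4 := by
      rw [degree_mul, degree_X, Cubic.degree_of_a_ne_zero hQa]; norm_num
    have hlt : P.toPoly.degree < (X * Q.toPoly).degree := by
      rw [hX]; exact lt_of_le_of_lt degree_cubic_le (by norm_num)
    have hd : (fixPoly P Q).degree = 4 := by rw [fixPoly, degree_sub_eq_left_of_degree_lt hlt, hX]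
    refine Polynomial.eq_of_degree_le_of_eval_index_eq Finset.univ hx.injOn ?_ ?_ ?_ ?_
    · rw [hd]; rfl
    · rw [hd, degree_C_mul hQa, Lagrange.degree_nodal]; rfl
    · rw [fixPoly, leadingCoeff_sub_of_degree_lt hlt, leadingCoeff_mul, leadingCoeff_X, one_mul,
        Cubic.leadingCoeff_of_a_ne_zero hQa, leadingCoeff_mul, leadingCoeff_C,
        Lagrange.nodal_monic.leadingCoeff, mul_one]
    · intro i _
      rw [hroot, eval_mul, Lagrange.eval_nodal_at_node (Finset.mem_univ i), mul_zero]
  have hq : ∀ i, Q.toPoly.eval (x i) ≠ 0 := by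
    intro i hi
    have := hroot i
    rw [fixPoly, eval_sub, eval_mul, hi, mul_zero, zero_sub, neg_eq_zero] at this
    rw [eval_toPoly] at this hi
    exact h.hom_ne_zero _ hi this
  have hmul : ∀ i, 1 - multiplier f (x i) =
      Q.a * (∏ j ∈ Finset.univ.erase i, (x i - x j)) / Q.toPoly.eval (x i) := by
    intro i
    have hd : (derivative (fixPoly P Q)).eval (x i) =
        Q.a * ∏ j ∈ Finset.univ.erase i, (x i - x j) := by
      rw [hF, derivative_C_mul, eval_C_mul,
        Lagrange.eval_nodal_derivative_eval_node_eq (Finset.mem_univ i), Lagrange.eval_nodal]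
    have h0 := hroot i
    change 1 - derivAt f (x i) = _
    rw [← hd, derivAt_of_mul_eq (hq i) h.mul_eq]
    simp only [fixPoly, derivative_sub, derivative_mul, derivative_X, one_mul, eval_sub, eval_add,
      eval_mul, eval_X] at h0 ⊢
    have := hq i
    rw [eq_div_iff this, sub_mul, sub_eq_iff_eq_add, ← sub_eq_iff_eq_add', eq_comm,
      div_mul_eq_mul_div, div_eq_iff (pow_ne_zero 2 this)]
    linear_combination ((derivative Q.toPoly).eval (x i) * Q.toPoly.eval (x i)) * h0
  have hprod : ∀ i, ∏ j ∈ Finset.univ.erase i, (x i - x j) ≠ 0 := fun i =>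
    Finset.prod_ne_zero_iff.mpr fun j hj => sub_ne_zero.mpr fun hij =>
      (Finset.mem_erase.mp hj).1 (hx hij).symm
  refine ⟨fun i hi => ?_, ?_⟩
  · have := hmul i
    rw [hi, sub_self] at this
    exact div_ne_zero (mul_ne_zero hQa (hprod i)) (hq i) this.symm
  · have hs := Lagrange.coeff_eq_sum (s := Finset.univ) (v := x) hx.injOn (P := Q.toPoly)
      (lt_of_le_of_lt degree_cubic_le (by simp; norm_num))
    simp only [Finset.card_univ, Fintype.card_fin] at hs
    rw [show 4 - 1 = 3 from rfl, Cubic.coeff_eq_a] at hs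
    apply mul_left_cancel₀ hQa
    rw [Finset.mul_sum, mul_one]
    conv_rhs => rw [hs]
    refine Finset.sum_congr rfl fun i _ => ?_
    rw [hmul i]
    have h1 := hprod i
    have h2 := hq i
    field_simp

end FixedPoints

/-! ### Sharp three-transitivity of the projective group of the line -/

section Projective

variable {L : Type*} [Field L]

theorem eq_of_coords_proportional {p q : OnePoint L}
    (h : (coords p).1 * (coords q).2 = (coords p).2 * (coords q).1) : p = q := by
  cases p <;> cases q <;> simp_all

theorem smul_eq_of_coords (A : GL (Fin 2) L) {p q : OnePoint L} {t : L}
    (h1 : A 0 0 * (coords p).1 + A 0 1 * (coords p).2 = t * (coords q).1)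
    (h2 : A 1 0 * (coords p).1 + A 1 1 * (coords p).2 = t * (coords q).2) : A • p = q := by
  obtain ⟨s, hs, e1, e2⟩ := coords_smul A p
  apply eq_of_coords_proportional
  apply mul_left_cancel₀ hs
  by_cases ht : t = 0
  · have a1 : (coords (A • p)).1 = 0 := by
      have := e1.symm.trans h1; simpa [ht, hs] using this
    have a2 : (coords (A • p)).2 = 0 := by
      have := e2.symm.trans h2; simpa [ht, hs] using this
    exact absurd ⟨a1, a2⟩ (coords_ne_zero _)
  · apply mul_left_cancel₀ ht
    linear_combination t * ((coords q).1 * e2 - (coords q).2 * e1) +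
      t * ((coords q).2 * h1 - (coords q).1 * h2)

theorem mk_eq_one_of_smul_eq {A : GL (Fin 2) L} {p q r : OnePoint L} (hpq : p ≠ q) (hpr : p ≠ r)
    (hqr : q ≠ r) (hp : A • p = p) (hq : A • q = q) (hr : A • r = r) :
    (Matrix.ProjGenLinGroup.mk A : PGL(2, L)) = 1 := by
  -- every fixed point is a zero of one and the same binary quadratic form
  have key : ∀ s : OnePoint L, A • s = s → A 1 0 * (coords s).1 ^ 2 +
      (A 1 1 - A 0 0) * (coords s).1 * (coords s).2 - A 0 1 * (coords s).2 ^ 2 = 0 := by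
    intro s hs
    obtain ⟨t, -, e1, e2⟩ := coords_smul A s
    rw [hs] at e1 e2
    linear_combination (coords s).1 * e2 - (coords s).2 * e1
  have k1 := key p hp
  have k2 := key q hq
  have k3 := key r hr
  have h : A 1 0 = 0 ∧ A 0 1 = 0 ∧ A 1 1 = A 0 0 := by
    clear key hp hq hr
    cases p <;> cases q <;> cases r <;> simp at k1 k2 k3 hpq hpr hqr <;> grind
  have hdet := det_fin_two_ne_zero A
  have h0 : A 0 0 ≠ 0 := fun h0 => hdet (by rw [h0, h.1]; ring)
  rw [← Matrix.ProjGenLinGroup.mk_one, eq_comm, Matrix.ProjGenLinGroup.mk_eq_mk_iff]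
  refine ⟨Units.mk0 _ h0, ?_⟩
  ext i j
  fin_cases i <;> fin_cases j <;> simp [h.1, h.2.1, h.2.2]

/-- A projective transformation of the line is determined by its values at three points. -/
theorem mk_eq_mk_of_smul_eq {A B : GL (Fin 2) L} {p q r : OnePoint L} (hpq : p ≠ q) (hpr : p ≠ r)
    (hqr : q ≠ r) (hp : A • p = B • p) (hq : A • q = B • q) (hr : A • r = B • r) :
    (Matrix.ProjGenLinGroup.mk A : PGL(2, L)) = Matrix.ProjGenLinGroup.mk B := by
  have := mk_eq_one_of_smul_eq (A := B⁻¹ * A) hpq hpr hqr (by rw [mul_smul, hp, inv_smul_smul])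
    (by rw [mul_smul, hq, inv_smul_smul]) (by rw [mul_smul, hr, inv_smul_smul])
  rw [map_mul, map_inv, inv_mul_eq_one] at this
  exact this.symm

theorem mk_eq_mk_of_eqOn {A B : GL (Fin 2) L} {T : Set (OnePoint L)} (hT : 3 ≤ T.ncard)
    (h : ∀ p ∈ T, A • p = B • p) :
    (Matrix.ProjGenLinGroup.mk A : PGL(2, L)) = Matrix.ProjGenLinGroup.mk B := by
  have hfin : T.Finite := Set.finite_of_ncard_ne_zero (by omega)
  obtain ⟨p, q, r, hp, hq, hr, hpq, hpr, hqr⟩ := (Set.two_lt_ncard_iff hfin).mp hT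
  exact mk_eq_mk_of_smul_eq hpq hpr hqr (h p hp) (h q hq) (h r hr)

/-- Some projective transformation sends `∞, 0, 1` to three given distinct points. -/
theorem exists_smul_standard {p q r : OnePoint L} (hpq : p ≠ q) (hpr : p ≠ r) (hqr : q ≠ r) :
    ∃ A : GL (Fin 2) L, A • (∞ : OnePoint L) = p ∧ A • ((0 : L) : OnePoint L) = q ∧
      A • ((1 : L) : OnePoint L) = r := by
  obtain ⟨u, hu⟩ : ∃ u, u = (coords r).1 * (coords q).2 - (coords r).2 * (coords q).1 := ⟨_, rfl⟩
  obtain ⟨v, hv⟩ : ∃ v, v = (coords p).1 * (coords r).2 - (coords p).2 * (coords r).1 := ⟨_, rfl⟩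
  obtain ⟨w, hw⟩ : ∃ w, w = (coords p).1 * (coords q).2 - (coords p).2 * (coords q).1 := ⟨_, rfl⟩
  have hu0 : u ≠ 0 := fun h0 => hqr (eq_of_coords_proportional (by linear_combination h0 - hu)).symm
  have hv0 : v ≠ 0 := fun h0 => hpr (eq_of_coords_proportional (by linear_combination h0 - hv))
  have hw0 : w ≠ 0 := fun h0 => hpq (eq_of_coords_proportional (by linear_combination h0 - hw))
  -- the columns are multiples of representatives of `p` and `q` that add up to one of `r`
  let A : GL (Fin 2) L := Matrix.GeneralLinearGroup.mkOfDetNeZero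
    !![u * (coords p).1, v * (coords q).1; u * (coords p).2, v * (coords q).2] (by
      rw [Matrix.det_fin_two_of]
      have : u * v * w ≠ 0 := mul_ne_zero (mul_ne_zero hu0 hv0) hw0
      intro h0
      apply this
      rw [hw]
      linear_combination h0)
  have a00 : A 0 0 = u * (coords p).1 := rfl
  have a01 : A 0 1 = v * (coords q).1 := rfl
  have a10 : A 1 0 = u * (coords p).2 := rfl
  have a11 : A 1 1 = v * (coords q).2 := rfl
  refine ⟨A, smul_eq_of_coords A (t := u) ?_ ?_, smul_eq_of_coords A (t := v) ?_ ?_,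
    smul_eq_of_coords A (t := w) ?_ ?_⟩ <;>
    simp only [a00, a01, a10, a11, coords_infty, coords_coe, hu, hv, hw] <;> ring

/-- The projective transformations of the line act transitively on triples of distinct points. -/
theorem exists_smul_eq {E : Finset (OnePoint L × OnePoint L)} (hE : E.card = 3)
    (h1 : Set.InjOn Prod.fst (E : Set (OnePoint L × OnePoint L)))
    (h2 : Set.InjOn Prod.snd (E : Set (OnePoint L × OnePoint L))) :
    ∃ A : GL (Fin 2) L, ∀ e ∈ E, A • e.2 = e.1 := by
  obtain ⟨a, b, c, hab, hac, hbc, rfl⟩ := Finset.card_eq_three.mp hE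
  have ha : a ∈ (({a, b, c} : Finset _) : Set (OnePoint L × OnePoint L)) := by simp
  have hb : b ∈ (({a, b, c} : Finset _) : Set (OnePoint L × OnePoint L)) := by simp
  have hc : c ∈ (({a, b, c} : Finset _) : Set (OnePoint L × OnePoint L)) := by simp
  obtain ⟨A, hA1, hA2, hA3⟩ := exists_smul_standard (h1.ne ha hb hab) (h1.ne ha hc hac)
    (h1.ne hb hc hbc)
  obtain ⟨B, hB1, hB2, hB3⟩ := exists_smul_standard (h2.ne ha hb hab) (h2.ne ha hc hac)
    (h2.ne hb hc hbc)
  refine ⟨A * B⁻¹, ?_⟩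
  simp only [Finset.mem_insert, Finset.mem_singleton, forall_eq_or_imp, forall_eq]
  simp only [mul_smul, ← hB1, ← hB2, ← hB3, inv_smul_smul]
  exact ⟨hA1, hA2, hA3⟩

end Projective

/-! ### Galois action and descent -/

section GaloisAction

variable {K L : Type*} [Field K] [Field L] [Algebra K L]

/-- The image of a cubic under an automorphism of the field of coefficients. -/
def galCubic (σ : L ≃ₐ[K] L) (P : Cubic L) : Cubic L := P.map (σ : L →+* L)

/-- The image of a matrix under an automorphism of the field of coefficients. -/
def galGL (σ : L ≃ₐ[K] L) : GL (Fin 2) L →* GL (Fin 2) L :=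
  Matrix.GeneralLinearGroup.map (σ : L →+* L)

theorem galGL_apply (σ : L ≃ₐ[K] L) (A : GL (Fin 2) L) (i j : Fin 2) :
    galGL σ A i j = σ (A i j) := rfl

@[simp] theorem galAct_infty (σ : L ≃ₐ[K] L) : galAct σ (∞ : OnePoint L) = ∞ := rfl

@[simp] theorem galAct_coe (σ : L ≃ₐ[K] L) (x : L) :
    galAct σ (x : OnePoint L) = ((σ x : L) : OnePoint L) := rfl

theorem galAct_symm_galAct (σ : L ≃ₐ[K] L) (p : OnePoint L) : galAct σ.symm (galAct σ p) = p := by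
  cases p <;> simp

theorem galAct_galAct_symm (σ : L ≃ₐ[K] L) (p : OnePoint L) : galAct σ (galAct σ.symm p) = p := by
  cases p <;> simp

theorem galAct_injective (σ : L ≃ₐ[K] L) : Function.Injective (galAct σ) :=
  Function.LeftInverse.injective (galAct_symm_galAct σ)

theorem galAct_smul (σ : L ≃ₐ[K] L) (A : GL (Fin 2) L) (p : OnePoint L) :
    galAct σ (A • p) = galGL σ A • galAct σ p :=
  OnePoint.map_smul (σ : L →+* L) A p

theorem coords_galAct (σ : L ≃ₐ[K] L) (p : OnePoint L) :
    coords (galAct σ p) = (σ (coords p).1, σ (coords p).2) := by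
  cases p <;> simp

theorem isGaloisInvariant_of_mapsTo {S : Set (OnePoint L)}
    (h : ∀ σ : L ≃ₐ[K] L, ∀ p ∈ S, galAct σ p ∈ S) : IsGaloisInvariant K S := by
  intro σ
  refine Set.Subset.antisymm (Set.image_subset_iff.mpr (h σ)) fun p hp =>
    ⟨galAct σ.symm p, h _ p hp, galAct_galAct_symm σ p⟩

theorem IsGaloisInvariant.galAct_mem {S : Set (OnePoint L)} (h : IsGaloisInvariant K S)
    (σ : L ≃ₐ[K] L) {p : OnePoint L} (hp : p ∈ S) : galAct σ p ∈ S :=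
  h σ ▸ Set.mem_image_of_mem _ hp

theorem hom_galCubic (σ : L ≃ₐ[K] L) (P : Cubic L) (x y : L) :
    hom (galCubic σ P) (σ x) (σ y) = σ (hom P x y) := by
  simp [galCubic, Cubic.map, hom]

theorem trace_galCubic (σ : L ≃ₐ[K] L) (P Q : Cubic L) (x y : L) :
    trace (galCubic σ P) (galCubic σ Q) (σ x) (σ y) = σ (trace P Q x y) := by
  simp [galCubic, Cubic.map, trace, _root_.map_ofNat]

theorem toPoly_galCubic (σ : L ≃ₐ[K] L) (P : Cubic L) :
    (galCubic σ P).toPoly = P.toPoly.map (σ : L →+* L) := Cubic.map_toPoly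

theorem conjFst_galCubic (σ : L ≃ₐ[K] L) (A : GL (Fin 2) L) (P Q : Cubic L) :
    conjFst (galGL σ A) (galCubic σ P) (galCubic σ Q) = galCubic σ (conjFst A P Q) := by
  ext <;> simp [conjFst, galCubic, Cubic.map, subst, hom, galGL_apply, _root_.map_ofNat]

theorem conjSnd_galCubic (σ : L ≃ₐ[K] L) (A : GL (Fin 2) L) (P Q : Cubic L) :
    conjSnd (galGL σ A) (galCubic σ P) (galCubic σ Q) = galCubic σ (conjSnd A P Q) := by
  ext <;> simp [conjSnd, galCubic, Cubic.map, subst, hom, galGL_apply, _root_.map_ofNat]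

variable {f : RatFunc L} {P Q : Cubic L}

/-- The Galois conjugates of a lift of a map defined over `K` are lifts of the same map. -/
theorem IsLift.galCubic (h : IsLift f P Q) (hf : IsDefinedOver K f) (σ : L ≃ₐ[K] L) :
    IsLift f (galCubic σ P) (galCubic σ Q) := by
  obtain ⟨p, q, hq, hpq⟩ := hf
  have hq' : q.map (algebraMap K L) ≠ 0 := Polynomial.map_ne_zero hq
  have hσQ : (RatMap.galCubic σ Q).toPoly ≠ 0 := by
    rw [toPoly_galCubic]; exact Polynomial.map_ne_zero h.toPoly_ne_zero
  refine ⟨fun h0 => hσQ ((Cubic.toPoly_eq_zero_iff _).mpr h0), ?_, ?_⟩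
  · have e : P.toPoly * q.map (algebraMap K L) = p.map (algebraMap K L) * Q.toPoly := by
      apply RatFunc.algebraMap_injective L
      rw [map_mul, map_mul, ← h.mul_eq, hpq]
      have := algebraMap_ne_zero hq'
      field_simp
    have hcomp : ∀ r : K[X], (r.map (algebraMap K L)).map (σ : L →+* L) =
        r.map (algebraMap K L) := by
      intro r
      rw [Polynomial.map_map]
      congr 1
      ext x
      simp
    have e' := congrArg (Polynomial.map (σ : L →+* L)) e
    rw [Polynomial.map_mul, Polynomial.map_mul, hcomp, hcomp, ← toPoly_galCubic,
      ← toPoly_galCubic] at e'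
    rw [hpq, div_mul_eq_mul_div, div_eq_iff (algebraMap_ne_zero hq'), ← map_mul, ← map_mul, e']
  · intro x y h1 h2
    have hx : σ (σ.symm x) = x := σ.apply_symm_apply x
    have hy : σ (σ.symm y) = y := σ.apply_symm_apply y
    rw [← hx, ← hy, hom_galCubic, map_eq_zero] at h1 h2
    have := h.nondeg _ _ h1 h2
    simpa using this

/-- Galois descent for rational functions: if every Galois conjugate of a lift of `f` is again a
lift of `f`, then `f` is defined over the base field. -/
theorem IsLift.isDefinedOver [IsGalois K L] (h : IsLift f P Q)
    (hσ : ∀ σ : L ≃ₐ[K] L, IsLift f (RatMap.galCubic σ P) (RatMap.galCubic σ Q)) :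
    IsDefinedOver K f := by
  obtain ⟨k, hk, hP, hQ⟩ := exists_eq_mul h.toPoly_ne_zero h.mul_eq
  have hden0 := RatFunc.denom_ne_zero f
  -- the reduced fraction is unique once its denominator is monic
  have hden : ∀ σ : L ≃ₐ[K] L, f.denom.map (σ : L →+* L) = f.denom ∧
      f.num.map (σ : L →+* L) = f.num := by
    intro σ
    have hk' : k.map (σ : L →+* L) ≠ 0 := Polynomial.map_ne_zero hk
    have hd' : f.denom.map (σ : L →+* L) ≠ 0 := Polynomial.map_ne_zero hden0
    have e := (hσ σ).mul_eq
    rw [toPoly_galCubic, toPoly_galCubic, hP, hQ, Polynomial.map_mul, Polynomial.map_mul, map_mul,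
      map_mul, ← mul_assoc] at e
    replace e := mul_right_cancel₀ (algebraMap_ne_zero hk') e
    obtain ⟨u, hu, hn, hd⟩ := exists_eq_mul hd' e
    have hmon := RatFunc.monic_denom f
    have h1 : f.denom.map (σ : L →+* L) = f.denom :=
      eq_of_monic_of_dvd_of_natDegree_le hmon (hmon.map _) ⟨u, hd⟩
        natDegree_map_le
    refine ⟨h1, ?_⟩
    rw [h1] at hd
    have hu1 : u = 1 := mul_left_cancel₀ hden0 (by rw [← hd, mul_one])
    rw [hn, hu1, mul_one]
  have key : ∀ r : L[X], (∀ σ : L ≃ₐ[K] L, r.map (σ : L →+* L) = r) →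
      ∃ s : K[X], s.map (algebraMap K L) = r := by
    intro r hr
    rw [← mem_lifts, lifts_iff_coeff_lifts]
    intro n
    rw [InfiniteGalois.mem_range_algebraMap_iff_fixed]
    intro σ
    have := congrArg (fun p => coeff p n) (hr σ)
    simpa using this
  obtain ⟨p, hp⟩ := key _ fun σ => (hden σ).2
  obtain ⟨q, hq⟩ := key _ fun σ => (hden σ).1
  refine ⟨p, q, ?_, ?_⟩
  · rintro rfl
    rw [Polynomial.map_zero] at hq
    exact hden0 hq.symm
  · rw [hp, hq, RatFunc.num_div_denom]

theorem galAct_mem_fix (hdeg : deg f = 3) (hf : IsDefinedOver K f) (σ : L ≃ₐ[K] L)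
    {p : OnePoint L} (hp : p ∈ Fix f) : galAct σ p ∈ Fix f := by
  obtain ⟨P, Q, h⟩ := exists_isLift hdeg
  rw [h.mem_fix] at hp
  rw [(h.galCubic hf σ).mem_fix, coords_galAct]
  unfold fixForm at hp ⊢
  rw [hom_galCubic, hom_galCubic, ← map_mul, ← map_mul, ← map_sub, hp, map_zero]

theorem multiplier_galAct (hdeg : deg f = 3) (hf : IsDefinedOver K f) (σ : L ≃ₐ[K] L)
    {p : OnePoint L} (hp : p ∈ Fix f) : multiplier f (galAct σ p) = σ (multiplier f p) := by
  obtain ⟨P, Q, h⟩ := exists_isLift hdeg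
  obtain ⟨c, hc, hP, hQ⟩ := h.exists_eigenvalue (coords_ne_zero _) ((h.mem_fix _).mp hp)
  rw [h.multiplier_coords hc hP hQ, (h.galCubic hf σ).multiplier_coords (c := σ c)]
  · rw [coords_galAct, trace_galCubic]
    simp [_root_.map_ofNat]
  · simpa using hc
  · rw [coords_galAct, hom_galCubic, hP, map_mul]
  · rw [coords_galAct, hom_galCubic, hQ, map_mul]

/-- A conjugate of a map defined over `K` is defined over `K` if and only if it does not change when
the conjugating matrix is replaced by any of its Galois conjugates. -/
theorem isDefinedOver_conjGL_iff [IsAlgClosed L] [IsGalois K L] (hdeg : deg f = 3)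
    (hf : IsDefinedOver K f) (A : GL (Fin 2) L) :
    IsDefinedOver K (conjGL A f) ↔ ∀ σ : L ≃ₐ[K] L, conjGL (galGL σ A) f = conjGL A f := by
  obtain ⟨P, Q, h⟩ := exists_isLift hdeg
  have key : ∀ σ : L ≃ₐ[K] L, IsLift (conjGL (galGL σ A) f) (RatMap.galCubic σ (conjFst A P Q))
      (RatMap.galCubic σ (conjSnd A P Q)) := by
    intro σ
    rw [← conjFst_galCubic, ← conjSnd_galCubic]
    exact (h.galCubic hf σ).conj _
  refine ⟨fun hg σ => (key σ).unique ((h.conj A).galCubic hg σ), fun hg => ?_⟩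
  refine (h.conj A).isDefinedOver fun σ => ?_
  rw [← hg σ]
  exact key σ

/-- A finite set of at most three pairs of points, stable under Galois, is interpolated by a
projective transformation that is its own Galois conjugate: when there are fewer than three pairs,
pairs of points of `K` may be added. -/
theorem exists_equivariant_smul_eq [Infinite K] {E : Finset (OnePoint L × OnePoint L)}
    (hE : E.card ≤ 3) (h1 : Set.InjOn Prod.fst (E : Set (OnePoint L × OnePoint L)))
    (h2 : Set.InjOn Prod.snd (E : Set (OnePoint L × OnePoint L)))
    (hinv : ∀ σ : L ≃ₐ[K] L, ∀ e ∈ E, (galAct σ e.1, galAct σ e.2) ∈ E) :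
    ∃ A : GL (Fin 2) L, (∀ e ∈ E, A • e.2 = e.1) ∧ ∀ σ : L ≃ₐ[K] L,
      (Matrix.ProjGenLinGroup.mk (galGL σ A) : PGL(2, L)) = Matrix.ProjGenLinGroup.mk A := by
  obtain ⟨k, hk⟩ := Nat.exists_eq_add_of_le hE
  induction k generalizing E with
  | zero =>
    obtain ⟨A, hA⟩ := exists_smul_eq hk.symm h1 h2
    refine ⟨A, hA, fun σ => ?_⟩
    apply mk_eq_mk_of_eqOn (T := ((E.image Prod.snd : Finset _) : Set (OnePoint L)))
    · rw [Set.ncard_coe_finset, Finset.card_image_of_injOn h2]; omega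
    · intro p hp
      obtain ⟨e, he, rfl⟩ := Finset.mem_image.mp (Finset.mem_coe.mp hp)
      have e1 := hinv σ.symm e he
      have e2 := congrArg (galAct σ) (hA _ e1)
      rw [galAct_smul, galAct_galAct_symm, galAct_galAct_symm] at e2
      rw [e2, hA e he]
  | succ k ih =>
    have hinj : Function.Injective fun a : K => ((algebraMap K L a : L) : OnePoint L) :=
      OnePoint.coe_injective.comp (algebraMap K L).injective
    obtain ⟨_, ⟨a, rfl⟩, ha⟩ := (Set.infinite_range_of_injective hinj).exists_notMem_finset
      (E.image Prod.fst)
    obtain ⟨_, ⟨b, rfl⟩, hb⟩ := (Set.infinite_range_of_injective hinj).exists_notMem_finset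
      (E.image Prod.snd)
    set e₀ : OnePoint L × OnePoint L := ((algebraMap K L a : L), (algebraMap K L b : L)) with he₀
    have hnot : e₀ ∉ E := fun h => ha (Finset.mem_image_of_mem Prod.fst h)
    have hcard := Finset.card_insert_of_notMem hnot
    obtain ⟨A, hA, hσ⟩ := ih (E := insert e₀ E) (by omega)
      (by
        rw [Finset.coe_insert, Set.injOn_insert (by simpa using hnot)]
        exact ⟨h1, by simpa using ha⟩)
      (by
        rw [Finset.coe_insert, Set.injOn_insert (by simpa using hnot)]
        exact ⟨h2, by simpa using hb⟩)
      (by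
        intro σ e he
        rcases Finset.mem_insert.mp he with rfl | he
        · simp [he₀]
        · exact Finset.mem_insert_of_mem (hinv σ e he))
      (by omega)
    exact ⟨A, fun e he => hA e (Finset.mem_insert_of_mem he), hσ⟩

end GaloisAction

/-! ### Fixed points normalized by a conjugation -/

section Main

variable {K L : Type*} [Field K] [Field L] [Algebra K L] {f : RatFunc L}

theorem conjGL_eq_of_mk_eq {A B : GL (Fin 2) L}
    (h : (Matrix.ProjGenLinGroup.mk A : PGL(2, L)) = Matrix.ProjGenLinGroup.mk B) :
    conjGL A f = conjGL B f := by
  rw [← conj_mk, h, conj_mk]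

/-- The fixed points of `f` that `A⁻¹` sends to their multipliers. -/
def normalizedFix (A : GL (Fin 2) L) (f : RatFunc L) : Set (OnePoint L) :=
  {p ∈ Fix f | A • ((multiplier f p : L) : OnePoint L) = p}

theorem injOn_multiplier_normalizedFix (A : GL (Fin 2) L) (f : RatFunc L) :
    Set.InjOn (multiplier f) (normalizedFix A f) := by
  intro p hp q hq h
  rw [← hp.2, ← hq.2, h]

theorem isGaloisInvariant_fix (hdeg : deg f = 3) (hf : IsDefinedOver K f) :
    IsGaloisInvariant K (Fix f) :=
  isGaloisInvariant_of_mapsTo fun σ _ hp => galAct_mem_fix hdeg hf σ hp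

/-- Applying an automorphism `σ` to `A • multiplier f p = q`. -/
theorem galGL_smul_multiplier (hdeg : deg f = 3) (hf : IsDefinedOver K f) (σ : L ≃ₐ[K] L)
    {A : GL (Fin 2) L} {p q : OnePoint L} (hp : p ∈ Fix f)
    (h : A • ((multiplier f p : L) : OnePoint L) = q) :
    galGL σ A • ((multiplier f (galAct σ p) : L) : OnePoint L) = galAct σ q := by
  rw [← h, galAct_smul, galAct_coe, multiplier_galAct hdeg hf σ hp]

variable [IsAlgClosed L]

theorem smul_mem_fix_of_conjGL_eq (hdeg : deg f = 3) {B : GL (Fin 2) L} (hB : conjGL B f = f)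
    {p : OnePoint L} (hp : p ∈ Fix f) : B • p ∈ Fix f := by
  rw [← mem_fix_conjGL hdeg, hB]; exact hp

theorem multiplier_smul_of_conjGL_eq (hdeg : deg f = 3) {B : GL (Fin 2) L} (hB : conjGL B f = f)
    {p : OnePoint L} (hp : p ∈ Fix f) : multiplier f (B • p) = multiplier f p := by
  rw [← multiplier_conjGL hdeg B (smul_mem_fix_of_conjGL_eq hdeg hB hp), hB]

theorem fix_conjGL (hdeg : deg f = 3) (A : GL (Fin 2) L) :
    Fix (conjGL A f) = (fun p => A⁻¹ • p) '' Fix f := by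
  ext p
  rw [mem_fix_conjGL hdeg]
  constructor
  · intro h
    exact ⟨_, h, inv_smul_smul A p⟩
  · rintro ⟨q, hq, rfl⟩
    simpa using hq

theorem ncard_fix_conjGL (hdeg : deg f = 3) (A : GL (Fin 2) L) :
    (Fix (conjGL A f)).ncard = (Fix f).ncard := by
  rw [fix_conjGL hdeg, Set.ncard_image_of_injective _ (MulAction.injective A⁻¹)]

theorem eq_multiplier_conjGL_iff (hdeg : deg f = 3) (A : GL (Fin 2) L) {p : OnePoint L}
    (hp : A • p ∈ Fix f) :
    p = ((multiplier (conjGL A f) p : L) : OnePoint L) ↔ A • p ∈ normalizedFix A f := by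
  rw [multiplier_conjGL hdeg A hp, normalizedFix, Set.mem_sep_iff, and_iff_right hp,
    smul_left_cancel_iff, eq_comm]

theorem ncard_normalizedFix (hdeg : deg f = 3) (A : GL (Fin 2) L) :
    {p ∈ Fix (conjGL A f) | p = ((multiplier (conjGL A f) p : L) : OnePoint L)}.ncard =
      (normalizedFix A f).ncard := by
  have : normalizedFix A f = (fun p => A • p) ''
      {p ∈ Fix (conjGL A f) | p = ((multiplier (conjGL A f) p : L) : OnePoint L)} := by
    ext p
    constructor
    · intro hp
      have hp' : A • A⁻¹ • p ∈ normalizedFix A f := by rwa [smul_inv_smul]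
      exact ⟨A⁻¹ • p, ⟨(mem_fix_conjGL hdeg A _).mpr hp'.1,
        (eq_multiplier_conjGL_iff hdeg A hp'.1).mpr hp'⟩, smul_inv_smul A p⟩
    · rintro ⟨q, ⟨hq, hq'⟩, rfl⟩
      exact (eq_multiplier_conjGL_iff hdeg A ((mem_fix_conjGL hdeg A _).mp hq)).mp hq'
  rw [this, Set.ncard_image_of_injective _ (MulAction.injective A)]

/-- Partial fixed-point multiplier form of a conjugate, in terms of the original map. -/
theorem isPartial_conjGL_iff (hdeg : deg f = 3) (A : GL (Fin 2) L) :
    IsPartialFixedPointMultiplierForm (conjGL A f) ↔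
      ((Fix f).ncard ≤ 3 ∧ normalizedFix A f = Fix f) ∨
      ((Fix f).ncard = 4 ∧ 3 ≤ (normalizedFix A f).ncard) := by
  unfold IsPartialFixedPointMultiplierForm
  rw [ncard_fix_conjGL hdeg, ncard_normalizedFix hdeg]
  refine or_congr (and_congr_right fun _ => ?_) Iff.rfl
  constructor
  · intro h
    refine Set.Subset.antisymm (Set.sep_subset _ _) fun p hp => ?_
    have hp' : A • A⁻¹ • p ∈ Fix f := by rwa [smul_inv_smul]
    have := (eq_multiplier_conjGL_iff hdeg A hp').mp (h _ ((mem_fix_conjGL hdeg A _).mpr hp'))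
    rwa [smul_inv_smul] at this
  · intro h p hp
    have hp' := (mem_fix_conjGL hdeg A p).mp hp
    exact (eq_multiplier_conjGL_iff hdeg A hp').mpr (h ▸ hp')

/-! ### Normalizing the fixed points -/

/-- A Galois-invariant set of at most three fixed points with distinct multipliers can be moved to
the multipliers by a conjugation that keeps the map defined over `K`. -/
theorem exists_normalizing_of_invariant [Infinite K] [IsGalois K L] (hdeg : deg f = 3)
    (hf : IsDefinedOver K f) {S : Set (OnePoint L)} (hS : S ⊆ Fix f) (hcard : S.ncard ≤ 3)
    (hinv : IsGaloisInvariant K S) (hinj : Set.InjOn (multiplier f) S) :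
    ∃ A : GL (Fin 2) L, S ⊆ normalizedFix A f ∧ IsDefinedOver K (conjGL A f) := by
  have hfin : S.Finite := (fix_finite_and_ncard_le hdeg).1.subset hS
  set E : Finset (OnePoint L × OnePoint L) :=
    hfin.toFinset.image (fun p => (p, ((multiplier f p : L) : OnePoint L))) with hE
  have hmem : ∀ e, e ∈ E ↔ ∃ p ∈ S, (p, ((multiplier f p : L) : OnePoint L)) = e := by
    intro e; simp [hE]
  obtain ⟨A, hA, hσ⟩ := exists_equivariant_smul_eq (K := K) (E := E)
    (Finset.card_image_le.trans (by rwa [← Set.ncard_eq_toFinset_card S hfin]))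
    (by
      intro e he e' he' h
      obtain ⟨p, hp, rfl⟩ := (hmem e).mp he
      obtain ⟨q, hq, rfl⟩ := (hmem e').mp he'
      obtain rfl : p = q := h
      rfl)
    (by
      intro e he e' he' h
      obtain ⟨p, hp, rfl⟩ := (hmem e).mp he
      obtain ⟨q, hq, rfl⟩ := (hmem e').mp he'
      rw [hinj hp hq (OnePoint.coe_injective h)])
    (by
      intro σ e he
      obtain ⟨p, hp, rfl⟩ := (hmem e).mp he
      exact (hmem _).mpr ⟨galAct σ p, hinv.galAct_mem σ hp, by
        rw [multiplier_galAct hdeg hf σ (hS hp), galAct_coe]⟩)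
  exact ⟨A, fun p hp => ⟨hS hp, hA _ ((hmem _).mpr ⟨p, hp, rfl⟩)⟩,
    (isDefinedOver_conjGL_iff hdeg hf A).mpr fun σ => conjGL_eq_of_mk_eq (hσ σ)⟩

/-- If an automorphism `B` of `f` moves the fixed point `p`, and Galois moves `p` at most to `B •
p`, then the fixed points other than `B • p` can be moved to their multipliers: the Galois
conjugates of the conjugating matrix differ from it by a power of `B`. -/
theorem exists_normalizing_of_aut [IsGalois K L] (hdeg : deg f = 3) (hf : IsDefinedOver K f)
    (hn : (Fix f).ncard = 4) (hm : 3 ≤ (multiplier f '' Fix f).ncard) {B : GL (Fin 2) L}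
    (hB : conjGL B f = f) {p : OnePoint L} (hp : p ∈ Fix f) (hBp : B • p ≠ p)
    (hσp : ∀ σ : L ≃ₐ[K] L, galAct σ p = p ∨ galAct σ p = B • p) :
    ∃ A : GL (Fin 2) L, 3 ≤ (normalizedFix A f).ncard ∧ IsDefinedOver K (conjGL A f) := by
  have hBF := fun {t} ht => smul_mem_fix_of_conjGL_eq hdeg hB (p := t) ht
  have hBm := fun {t} ht => multiplier_smul_of_conjGL_eq hdeg hB (p := t) ht
  have hfin : (Fix f).Finite := (fix_finite_and_ncard_le hdeg).1
  obtain ⟨S, hSdef⟩ : ∃ S, S = Fix f \ {B • p} := ⟨_, rfl⟩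
  have hSF : S ⊆ Fix f := hSdef ▸ Set.sdiff_subset
  have hmem : ∀ t, t ∈ S ↔ t ∈ Fix f ∧ t ≠ B • p := fun t => by rw [hSdef]; rfl
  have hSfin : S.Finite := hfin.subset hSF
  have hpS : p ∈ S := (hmem p).mpr ⟨hp, hBp.symm⟩
  have hScard : S.ncard = 3 := by
    rw [hSdef, Set.ncard_sdiff_singleton_of_mem (hBF hp), hn]
  have hinj : Set.InjOn (multiplier f) S := by
    have himg : multiplier f '' Fix f = multiplier f '' S := by
      refine Set.Subset.antisymm ?_ (Set.image_mono hSF)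
      rintro _ ⟨t, ht, rfl⟩
      by_cases h : t = B • p
      · exact ⟨p, hpS, by rw [h, hBm hp]⟩
      · exact ⟨t, (hmem t).mpr ⟨ht, h⟩, rfl⟩
    apply Set.injOn_of_ncard_image_eq _ hSfin
    have := Set.ncard_image_le (f := multiplier f) hSfin
    rw [himg] at hm
    omega
  have hfixB : ∀ t ∈ S, t ≠ p → B • t = t := by
    intro t ht htp
    have h1 : B • t ∈ S := (hmem _).mpr ⟨hBF (hSF ht), fun h => htp (smul_left_cancel B h)⟩
    exact hinj h1 ht (hBm (hSF ht))
  set E : Finset (OnePoint L × OnePoint L) :=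
    hSfin.toFinset.image (fun p => (p, ((multiplier f p : L) : OnePoint L))) with hE
  have hEmem : ∀ e, e ∈ E ↔ ∃ p ∈ S, (p, ((multiplier f p : L) : OnePoint L)) = e := by
    intro e; simp [hE]
  obtain ⟨A, hA⟩ := exists_smul_eq (E := E)
    (by
      rw [hE, Finset.card_image_of_injective _ (fun a b h => congrArg Prod.fst h),
        ← Set.ncard_eq_toFinset_card S hSfin, hScard])
    (by
      intro e he e' he' h
      obtain ⟨p, hp, rfl⟩ := (hEmem e).mp he
      obtain ⟨q, hq, rfl⟩ := (hEmem e').mp he'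
      obtain rfl : p = q := h
      rfl)
    (by
      intro e he e' he' h
      obtain ⟨p, hp, rfl⟩ := (hEmem e).mp he
      obtain ⟨q, hq, rfl⟩ := (hEmem e').mp he'
      rw [hinj hp hq (OnePoint.coe_injective h)])
  have hAS : ∀ t ∈ S, A • ((multiplier f t : L) : OnePoint L) = t := fun t ht =>
    hA _ ((hEmem _).mpr ⟨t, ht, rfl⟩)
  refine ⟨A, ?_, (isDefinedOver_conjGL_iff hdeg hf A).mpr fun σ => ?_⟩
  · rw [← hScard]
    exact Set.ncard_le_ncard (fun t ht => ⟨hSF ht, hAS t ht⟩) (hfin.subset (Set.sep_subset _ _))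
  have hT : 3 ≤ ((fun t => ((multiplier f t : L) : OnePoint L)) '' S).ncard := by
    rw [Set.InjOn.ncard_image fun a ha b hb h => hinj ha hb (OnePoint.coe_injective h), hScard]
  have hmσp : multiplier f (galAct σ p) = multiplier f p := by
    rcases hσp σ with h | h
    · rw [h]
    · rw [h, hBm hp]
  -- the value of the conjugate of `A` at the multiplier of `t = σ s`, according to whether `s ∈ S`
  have hval : ∀ t ∈ S, ∃ s ∈ Fix f, galAct σ s = t ∧
      ((s ∈ S ∧ galGL σ A • ((multiplier f t : L) : OnePoint L) = t) ∨
        (s = B • p ∧ multiplier f t = multiplier f p ∧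
          galGL σ A • ((multiplier f t : L) : OnePoint L) = galAct σ p)) := by
    intro t ht
    have hs : galAct σ.symm t ∈ Fix f := galAct_mem_fix hdeg hf _ (hSF ht)
    have hst := galAct_galAct_symm σ t
    refine ⟨galAct σ.symm t, hs, hst, ?_⟩
    by_cases h : galAct σ.symm t = B • p
    · right
      refine ⟨h, ?_, ?_⟩
      · rw [← hst, h, multiplier_galAct hdeg hf σ (hBF hp), hBm hp,
          ← multiplier_galAct hdeg hf σ hp, hmσp]
      · have := galGL_smul_multiplier hdeg hf σ (A := A) (q := p) hs
          (by rw [h, hBm hp, hAS p hpS])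
        rwa [hst] at this
    · left
      have hsS := (hmem _).mpr ⟨hs, h⟩
      refine ⟨hsS, ?_⟩
      have := galGL_smul_multiplier hdeg hf σ hs (hAS _ hsS)
      rwa [hst] at this
  rcases hσp σ with hσ | hσ
  · apply conjGL_eq_of_mk_eq
    apply mk_eq_mk_of_eqOn hT
    rintro _ ⟨t, ht, rfl⟩
    simp only [hAS t ht]
    obtain ⟨s, hs, hst, ⟨-, h⟩ | ⟨-, h1, h2⟩⟩ := hval t ht
    · exact h
    · rw [h2, hσ, hinj ht hpS h1]
  · have hconj : conjGL (B * A) f = conjGL A f := by rw [conjGL_mul hdeg, hB]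
    rw [← hconj]
    apply conjGL_eq_of_mk_eq
    apply mk_eq_mk_of_eqOn hT
    rintro _ ⟨t, ht, rfl⟩
    simp only [mul_smul, hAS t ht]
    obtain ⟨s, hs, hst, ⟨hsS, h⟩ | ⟨-, h1, h2⟩⟩ := hval t ht
    · rw [h, hfixB t ht]
      rintro rfl
      have h3 : multiplier f s = multiplier f t := by
        apply σ.injective
        rw [← multiplier_galAct hdeg hf σ hs, ← multiplier_galAct hdeg hf σ hp, hst, hmσp]
      rw [hinj hsS hpS h3, hσ] at hst
      exact hBp hst
    · rw [h2, hσ, hinj ht hpS h1]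

/-! ### Maps with a normalized conjugate -/

/-- If all four fixed points are moved to their multipliers, the conjugate is the map determined by
these multipliers. -/
theorem isFourPointMap_conjGL (hdeg : deg f = 3) (hn : (Fix f).ncard = 4)
    {A : GL (Fin 2) L} (hA : normalizedFix A f = Fix f) (hg : IsDefinedOver K (conjGL A f)) :
    IsFixedPointMultiplierForm (conjGL A f) ∧ IsFourPointMap K (conjGL A f) := by
  have hdg := deg_conjGL hdeg A
  have hng := ncard_fix_conjGL hdeg A
  have hself : ∀ p ∈ Fix (conjGL A f), p = ((multiplier (conjGL A f) p : L) : OnePoint L) := by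
    intro p hp
    have hp' := (mem_fix_conjGL hdeg A p).mp hp
    exact (eq_multiplier_conjGL_iff hdeg A hp').mpr (hA ▸ hp')
  set g := conjGL A f
  have hform : IsFixedPointMultiplierForm g := ⟨by omega, hself⟩
  refine ⟨hform, ?_⟩
  have hfin : (multiplier g '' Fix g).Finite := (fix_finite_and_ncard_le hdg).1.image _
  have hcoe : Fix g = (fun x : L => (x : OnePoint L)) '' (multiplier g '' Fix g) := by
    rw [Set.image_image]
    ext p
    constructor
    · intro hp
      exact ⟨p, hp, (hself p hp).symm⟩
    · rintro ⟨q, hq, rfl⟩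
      change ((multiplier g q : L) : OnePoint L) ∈ Fix g
      rwa [← hself q hq]
  have hcard : hfin.toFinset.card = 4 := by
    rw [← Set.ncard_eq_toFinset_card _ hfin, ← hn, ← hng]
    conv_rhs => rw [hcoe, Set.ncard_image_of_injective _ OnePoint.coe_injective]
  let e := hfin.toFinset.equivFinOfCardEq hcard
  let x : Fin 4 → L := fun i => (e.symm i : L)
  have hx : Function.Injective x := Subtype.val_injective.comp e.symm.injective
  have hrange : Set.range x = multiplier g '' Fix g := by
    ext y
    constructor
    · rintro ⟨i, rfl⟩
      exact hfin.mem_toFinset.mp (e.symm i).2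
    · intro hy
      exact ⟨e ⟨y, hfin.mem_toFinset.mpr hy⟩, by simp [x]⟩
  have hfix : Fix g = Set.range fun i => (x i : OnePoint L) := by
    conv_lhs => rw [hcoe, ← hrange]
    exact (Set.range_comp _ _).symm
  have hmul : ∀ i, multiplier g (x i) = x i := fun i =>
    (OnePoint.coe_injective (hself (x i) (hfix ▸ ⟨i, rfl⟩))).symm
  obtain ⟨h1, h2⟩ := sum_one_div_one_sub_multiplier hdg hx hfix
  simp only [hmul] at h1 h2
  exact ⟨x, hx, h1, hfix ▸ isGaloisInvariant_fix hdg hg, h2, hdg, hg, hform, hfix⟩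

/-- If exactly three of four fixed points are moved to their multipliers by a conjugation defined
over `K`, then either Galois preserves these three, or a Galois conjugate of the conjugating matrix
differs from it by an automorphism of order two of `f`. -/
theorem invariant_or_aut (hdeg : deg f = 3) (hf : IsDefinedOver K f)
    [IsGalois K L] (hn : (Fix f).ncard = 4) {A : GL (Fin 2) L}
    (h3 : (normalizedFix A f).ncard = 3) (hg : IsDefinedOver K (conjGL A f)) :
    IsGaloisInvariant K (normalizedFix A f) ∨
      ((Aut f).ncard = 2 ∧ ∃ α ∈ Aut f, α ≠ 1 ∧ ∃ P ∈ Fix f, act α P ≠ P ∧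
        ∀ σ : L ≃ₐ[K] L, galAct σ P = P ∨ galAct σ P = act α P) := by
  have hconj := (isDefinedOver_conjGL_iff hdeg hf A).mp hg
  have hinj := injOn_multiplier_normalizedFix A f
  have hSF : normalizedFix A f ⊆ Fix f := Set.sep_subset _ _
  have hfin : (Fix f).Finite := (fix_finite_and_ncard_le hdeg).1
  have hgal : ∀ σ : L ≃ₐ[K] L, ∀ p ∈ normalizedFix A f,
      galGL σ A • ((multiplier f (galAct σ p) : L) : OnePoint L) = galAct σ p := fun σ p hp =>
    galGL_smul_multiplier hdeg hf σ hp.1 hp.2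
  by_cases hall : ∀ σ : L ≃ₐ[K] L,
      (Matrix.ProjGenLinGroup.mk (galGL σ A) : PGL(2, L)) = Matrix.ProjGenLinGroup.mk A
  · left
    refine isGaloisInvariant_of_mapsTo fun σ p hp => ⟨galAct_mem_fix hdeg hf σ hp.1, ?_⟩
    have h1 := hgal σ p hp
    rw [← act_mk, hall σ, act_mk] at h1
    exact h1
  right
  push Not at hall
  obtain ⟨σ₀, hσ₀⟩ := hall
  set S := normalizedFix A f
  obtain ⟨q, hq⟩ : ∃ q, Fix f \ S = {q} := by
    rw [← Set.ncard_eq_one, Set.ncard_sdiff hSF (hfin.subset hSF)]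
    omega
  have hqF : q ∈ Fix f := (hq.symm ▸ Set.mem_singleton q : q ∈ Fix f \ S).1
  have hqS : q ∉ S := (hq.symm ▸ Set.mem_singleton q : q ∈ Fix f \ S).2
  have hcases : ∀ p ∈ Fix f, p ∈ S ∨ p = q := by
    intro p hp
    by_cases h : p ∈ S
    · exact Or.inl h
    · exact Or.inr (hq ▸ (⟨hp, h⟩ : p ∈ Fix f \ S) : p ∈ ({q} : Set _))
  -- a nontrivial automorphism moves one point of `S` to `q` and fixes the other two
  have haut : ∀ C : GL (Fin 2) L, conjGL C f = f → (Matrix.ProjGenLinGroup.mk C : PGL(2, L)) ≠ 1 →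
      ∃ s ∈ S, C • s = q ∧ multiplier f s = multiplier f q ∧ ∀ t ∈ S, t ≠ s → C • t = t := by
    intro C hC hC1
    obtain ⟨s, hs, hCs⟩ : ∃ s ∈ S, C • s ≠ s := by
      by_contra! h
      exact hC1 (mk_eq_mk_of_eqOn (B := 1) h3.ge fun p hp => by rw [h p hp, one_smul])
    have hm : ∀ t ∈ S, multiplier f (C • t) = multiplier f t := fun t ht =>
      multiplier_smul_of_conjGL_eq hdeg hC (hSF ht)
    have hF : ∀ t ∈ S, C • t ∈ Fix f := fun t ht => smul_mem_fix_of_conjGL_eq hdeg hC (hSF ht)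
    have hsq : C • s = q := (hcases _ (hF s hs)).resolve_left fun h => hCs (hinj h hs (hm s hs))
    refine ⟨s, hs, hsq, by rw [← hsq, hm s hs], fun t ht hts => ?_⟩
    rcases hcases _ (hF t ht) with h | h
    · exact hinj h ht (hm t ht)
    · exact absurd (smul_left_cancel C (h.trans hsq.symm)) hts
  obtain ⟨B, hBdef⟩ : ∃ B, B = galGL σ₀ A * A⁻¹ := ⟨_, rfl⟩
  have hB : conjGL B f = f := by
    rw [hBdef, conjGL_mul hdeg, hconj, ← conjGL_mul hdeg, mul_inv_cancel, conjGL_one hdeg]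
  have hB1 : (Matrix.ProjGenLinGroup.mk B : PGL(2, L)) ≠ 1 := by
    rw [hBdef, map_mul, map_inv]
    exact fun h => hσ₀ (mul_inv_eq_one.mp h)
  obtain ⟨s, hs, hBs, hms, hBt⟩ := haut B hB hB1
  have hsq : s ≠ q := fun h => hqS (h ▸ hs)
  have hAut : Aut f = {1, Matrix.ProjGenLinGroup.mk B} := by
    ext α
    obtain ⟨C, rfl⟩ := Matrix.ProjGenLinGroup.mk_surjective α
    rw [Aut, Set.mem_ofPred_eq, conj_mk, Set.mem_insert_iff, Set.mem_singleton_iff]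
    constructor
    · intro hC
      by_cases hC1 : (Matrix.ProjGenLinGroup.mk C : PGL(2, L)) = 1
      · exact Or.inl hC1
      · right
        obtain ⟨s', hs', hCs, hms', hCt⟩ := haut C hC hC1
        obtain rfl : s' = s := hinj hs' hs (hms'.trans hms.symm)
        refine mk_eq_mk_of_eqOn h3.ge fun t ht => ?_
        by_cases hts : t = s'
        · rw [hts, hCs, hBs]
        · rw [hCt t ht hts, hBt t ht hts]
    · rintro (h | h)
      · rw [← Matrix.ProjGenLinGroup.mk_one] at h
        rw [conjGL_eq_of_mk_eq h, conjGL_one hdeg]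
      · rw [conjGL_eq_of_mk_eq h, hB]
  refine ⟨by rw [hAut, Set.ncard_pair hB1.symm], Matrix.ProjGenLinGroup.mk B,
    by rw [hAut]; simp, hB1, s, hSF hs, ?_, fun σ => ?_⟩
  · rw [act_mk, hBs]; exact hsq.symm
  · rw [act_mk, hBs]
    -- `s` and `q` are the only two fixed points with the same multiplier
    have hm : multiplier f (galAct σ s) = multiplier f (galAct σ q) := by
      rw [multiplier_galAct hdeg hf σ (hSF hs), multiplier_galAct hdeg hf σ hqF, hms]
    have hne : galAct σ s ≠ galAct σ q := fun h => hsq (galAct_injective σ h)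
    rcases hcases _ (galAct_mem_fix hdeg hf σ (hSF hs)) with h | h
    · rcases hcases _ (galAct_mem_fix hdeg hf σ hqF) with h' | h'
      · exact absurd (hinj h h' hm) hne
      · left
        exact hinj h hs (by rw [hm, h', hms])
    · exact Or.inr h

end Main
end RatMap

theorem mainTheorem2 {K L : Type*} [Field K] [CharZero K] [Field L] [Algebra K L]
    [IsAlgClosure K L] (f : RatFunc L) (hdeg : RatMap.deg f = 3) (hf : RatMap.IsDefinedOver K f) :
    (∃ ρ : PGL(2, L), RatMap.IsPartialFixedPointMultiplierForm (RatMap.conj ρ f) ∧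
        RatMap.IsDefinedOver K (RatMap.conj ρ f)) ↔
      min (RatMap.Fix f).ncard 3 ≤ (RatMap.multiplier f '' RatMap.Fix f).ncard ∧
      ((∃ S ⊆ RatMap.Fix f, S.ncard = min (RatMap.Fix f).ncard 3 ∧
          RatMap.IsGaloisInvariant K S ∧ Set.InjOn (RatMap.multiplier f) S) ∨
        ((RatMap.Aut f).ncard = 2 ∧ ∃ α ∈ RatMap.Aut f, α ≠ 1 ∧
          ∃ P ∈ RatMap.Fix f, RatMap.act α P ≠ P ∧
            ∀ σ : L ≃ₐ[K] L, RatMap.galAct σ P = P ∨ RatMap.galAct σ P = RatMap.act α P) ∨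
        (∃ ρ : PGL(2, L), RatMap.IsFixedPointMultiplierForm (RatMap.conj ρ f) ∧
          RatMap.IsFourPointMap K (RatMap.conj ρ f))) := by
  have : IsAlgClosed L := IsAlgClosure.isAlgClosed K
  have : Algebra.IsAlgebraic K L := IsAlgClosure.isAlgebraic
  have : IsGalois K L := ⟨⟩
  have : Infinite K := inferInstance
  obtain ⟨hfin, hle⟩ := RatMap.fix_finite_and_ncard_le hdeg
  constructor
  · rintro ⟨ρ, hpart, hg⟩
    obtain ⟨A, rfl⟩ := Matrix.ProjGenLinGroup.mk_surjective ρ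
    rw [RatMap.conj_mk] at hpart hg
    have hinj := RatMap.injOn_multiplier_normalizedFix A f
    have hsub : RatMap.normalizedFix A f ⊆ RatMap.Fix f := Set.sep_subset _ _
    have himg : (RatMap.normalizedFix A f).ncard ≤
        (RatMap.multiplier f '' RatMap.Fix f).ncard := by
      rw [← hinj.ncard_image]
      exact Set.ncard_le_ncard (Set.image_mono hsub) (hfin.image _)
    rcases (RatMap.isPartial_conjGL_iff hdeg A).mp hpart with ⟨hn, hS⟩ | ⟨hn, hS⟩
    · rw [hS] at hinj himg
      exact ⟨(min_le_left _ _).trans himg, Or.inl ⟨_, subset_rfl, (min_eq_left hn).symm,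
        RatMap.isGaloisInvariant_fix hdeg hf, hinj⟩⟩
    · refine ⟨(min_le_right _ _).trans (hS.trans himg), ?_⟩
      by_cases hall : RatMap.normalizedFix A f = RatMap.Fix f
      · refine Or.inr (Or.inr ⟨Matrix.ProjGenLinGroup.mk A, ?_⟩)
        rw [RatMap.conj_mk]
        exact RatMap.isFourPointMap_conjGL hdeg hn hall hg
      · have hlt := Set.ncard_lt_ncard (hsub.ssubset_of_ne hall) hfin
        have h3 : (RatMap.normalizedFix A f).ncard = 3 := by omega
        rcases RatMap.invariant_or_aut hdeg hf hn h3 hg with h | h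
        · exact Or.inl ⟨_, hsub, by rw [h3, hn]; rfl, h, hinj⟩
        · exact Or.inr (Or.inl h)
  · rintro ⟨h1, h2⟩
    suffices ∃ A : GL (Fin 2) L, RatMap.IsPartialFixedPointMultiplierForm (RatMap.conjGL A f) ∧
        RatMap.IsDefinedOver K (RatMap.conjGL A f) by
      obtain ⟨A, hA⟩ := this
      refine ⟨Matrix.ProjGenLinGroup.mk A, ?_⟩
      rw [RatMap.conj_mk]
      exact hA
    by_cases hn : (RatMap.Fix f).ncard ≤ 3
    · -- with at most three fixed points, the first condition alone suffices
      rw [min_eq_left hn] at h1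
      have hinj := Set.injOn_of_ncard_image_eq (le_antisymm (Set.ncard_image_le hfin) h1) hfin
      obtain ⟨A, hA, hg⟩ := RatMap.exists_normalizing_of_invariant hdeg hf subset_rfl hn
        (RatMap.isGaloisInvariant_fix hdeg hf) hinj
      exact ⟨A, (RatMap.isPartial_conjGL_iff hdeg A).mpr
        (Or.inl ⟨hn, Set.Subset.antisymm (Set.sep_subset _ _) hA⟩), hg⟩
    have hn4 : (RatMap.Fix f).ncard = 4 := by omega
    rw [hn4, show min 4 3 = 3 from rfl] at h1 h2
    rcases h2 with ⟨S, hSF, hS3, hinv, hinj⟩ | ⟨-, α, hα, -, P, hP, hαP, hσ⟩ | ⟨ρ, hform, hfour⟩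
    · obtain ⟨A, hA, hg⟩ := RatMap.exists_normalizing_of_invariant hdeg hf hSF hS3.le hinv hinj
      refine ⟨A, (RatMap.isPartial_conjGL_iff hdeg A).mpr (Or.inr ⟨hn4, ?_⟩), hg⟩
      rw [← hS3]
      exact Set.ncard_le_ncard hA (hfin.subset (Set.sep_subset _ _))
    · obtain ⟨B, rfl⟩ := Matrix.ProjGenLinGroup.mk_surjective α
      obtain ⟨A, hA, hg⟩ := RatMap.exists_normalizing_of_aut hdeg hf hn4 h1 hα hP hαP hσ
      exact ⟨A, (RatMap.isPartial_conjGL_iff hdeg A).mpr (Or.inr ⟨hn4, hA⟩), hg⟩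
    · obtain ⟨A, rfl⟩ := Matrix.ProjGenLinGroup.mk_surjective ρ
      rw [RatMap.conj_mk] at hform hfour
      obtain ⟨-, -, -, -, -, -, hg, -, -⟩ := hfour
      refine ⟨A, Or.inr ⟨by rw [RatMap.ncard_fix_conjGL hdeg, hn4], ?_⟩, hg⟩
      rw [Set.sep_eq_self_iff_mem_true.mpr hform.2]
      exact hform.1
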